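/- For $n\ge 1$ let $\mathbb B=\{-1,1\}^n$ with the Hamming distance $d(x,y)=\#\{i: x_i\ne y_i\}$, and let $\mu$ be the uniform probability measure on $\mathbb B$. Let $X_1,\dots,X_N$ be i.i.d. with law $\mu$, let $\mu_N=\frac1N\sum_{i=1}^N\delta_{X_i}$ be their empirical measure, and let $W(\nu_1,\nu_2)=\inf_\gamma\int d(x,y)\,d\gamma(x,y)$, the infimum over all couplings $\gamma$ of $\nu_1,\nu_2$, be the Wasserstein distance. All logarithms are natural, and $N=N_n$ depends on $n$; "$N=t_n$" means that $N_n$ is an integer with $|N_n-t_n|<1$ for all large $n$ (that is, $N_n=t_n$ up to rounding up or down to an integer). Then: 1. If $N=n^\alpha$ with $\alpha\ge 2$, then $$\sqrt{\tfrac{\alpha-2}{4}}\le\liminf_n\frac{\frac n2-\mathbb E[W(\mu_N,\mu)]}{\sqrt{n\log n}}\le\limsup_n\frac{\frac n2-\mathbb E[W(\mu_N,\mu)]}{\sqrt{n\log n}}\le\sqrt{\tfrac{\alpha+1}{2}}.$$ 2. If $N=e^{\lambda n}$ with $0<\lambda<\log 2$, let $H(x)=-x\log x-(1-x)\log(1-x)$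 and let $r^*$ be the unique point of $(0,\frac12)$ with $H(r^*)=\log 2-\lambda$. Then $$-\frac{1}{\log\frac{1-r^*}{r^*}}\le\liminf_n\frac{\mathbb E[W(\mu_N,\mu)]-r^*n}{\log n}\le\limsup_n\frac{\mathbb E[W(\mu_N,\mu)]-r^*n}{\log n}\le\frac{3.5}{\log\frac{1-r^*}{r^*}}.$$ 3. If $N=c\,2^n$ with a constant $c>0$, then $$e^{-c}\le\liminf_n\mathbb E[W(\mu_N,\mu)]\le\limsup_n\mathbb E[W(\mu_N,\mu)]\le\frac1{\sqrt{2c}}.$$ 4. If $N=c(n)\,2^n$ with $c(n)\to\infty$, then $$\sqrt{\tfrac1{2\pi}}\le\liminf_n\sqrt{c(n)}\,\mathbb E[W(\mu_N,\mu)]\le\limsup_n\sqrt{c(n)}\,\mathbb E[W(\mu_N,\mu)]\le\frac{\sqrt2}{2}.$$ -/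

import Mathlib

open Filter MeasureTheory ProbabilityTheory
open scoped ENNReal Topology

noncomputable section

/-- The Boolean cube `{-1, 1}^n` (`ℤˣ` consists of `1` and `-1`). As a `Hamming` type it is a metric
space whose distance is the number of coordinates in which two points differ. -/
abbrev BoolCube (n : ℕ) : Type := Hamming fun _ : Fin n => ℤˣ

/-- Every subset of the (finite) Boolean cube is measurable. -/
instance instMeasurableSpaceBoolCube (n : ℕ) : MeasurableSpace (BoolCube n) := ⊤

/-- The uniform probability measure on the Boolean cube: each point has mass `1 / 2 ^ n`. -/
def cubeUniform (n : ℕ) : Measure (BoolCube n) := ((2 : ℝ≥0∞) ^ n)⁻¹ • Measure.count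

/-- The empirical measure `(1 / N) ∑ i, δ_{x i}` of a sample of `N` points. -/
def empiricalMeasure {E : Type*} [MeasurableSpace E] {N : ℕ} (x : Fin N → E) : Measure E :=
  (N : ℝ≥0∞)⁻¹ • ∑ i, Measure.dirac (x i)

/-- The couplings of two measures: the measures on the product with the given marginals. -/
def couplings {E : Type*} [MeasurableSpace E] (m₁ m₂ : Measure E) : Set (Measure (E × E)) :=
  {γ | γ.map Prod.fst = m₁ ∧ γ.map Prod.snd = m₂}

/-- The (`L¹`-) Wasserstein distance `inf_γ ∫ d(x, y) dγ(x, y)`, with values in `[0, ∞]`. -/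
def wassersteinDist {E : Type*} [MeasurableSpace E] [MetricSpace E] (m₁ m₂ : Measure E) : ℝ≥0∞ :=
  ⨅ γ ∈ couplings m₁ m₂, ∫⁻ p, edist p.1 p.2 ∂γ

/-- `𝔼[W(μ_N, μ)]`, where `μ` is the uniform measure on the cube and `μ_N` the empirical measure
of the random points `X i`. -/
def meanMatchingDist {Ω : Type*} [MeasurableSpace Ω] (P : Measure Ω) {n N : ℕ}
    (X : Fin N → Ω → BoolCube n) : ℝ :=
  ∫ ω, (wassersteinDist (empiricalMeasure fun i => X i ω) (cubeUniform n)).toReal ∂P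

/-- `a ≤ liminf u ≤ limsup u ≤ b`, the limits being taken in the extended reals. -/
def LimitsBetween (a : ℝ) (u : ℕ → ℝ) (b : ℝ) : Prop :=
  (a : EReal) ≤ liminf (fun n => (u n : EReal)) atTop ∧
  liminf (fun n => (u n : EReal)) atTop ≤ limsup (fun n => (u n : EReal)) atTop ∧
  limsup (fun n => (u n : EReal)) atTop ≤ (b : EReal)

end

/-! ### Transport plans on a finite metric space -/

section Transport

variable {E : Type*} [Fintype E]

/-! On a finite space the Wasserstein distance is a linear programme: explicit transport bounds it
from above, explicit dual potentials bound it from below. Which choice is efficient depends on the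
density `N / 2 ^ n`.

Sparse samples (`N` polynomial, or exponential below `2 ^ n`): as long as `N` Hamming balls of
radius `κ` have small total measure, most points are at distance at least `κ` from the sample, so
most mass travels that far; a Chernoff bound for the ball makes this quantitative
(`le_meanCubeDist_of_ball`). For the upper bound each sample point is spread out by a radial
probability kernel. The result is nearly uniform once its variance is small, and the remaining
discrepancy is repaired at cost of order `n` per unit of mass (`meanCubeDist_le_of_radial`).
Independent coordinate flips serve the polynomial case, a single sphere the exponential one; the
kernel is just wide enough for the repair to cost `O(1)`.

Dense samples (`N` of order `2 ^ n` or more): mass missing at a point must come from distance at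
least `1`, and the mean deficit of a binomial count has a closed form due to de Moivre
(`le_meanCubeDist_of_deviation`). The upper bound sends mass along edges by the gradient of the
Green function applied to the empirical measure minus the uniform one. Orthogonality of Walsh
functions reduces its mean size to `∑ k, n.choose k / k`, which is about `2 ^ (n + 1) / n`
(`meanCubeDist_le_green`).

These bounds hold for fixed `n` and `N`, where every expectation is a finite sum; only afterwards
are the parameters tuned and limits taken. -/

lemma sum_sum_single_mul [DecidableEq E] (a b : E) (c : E → E → ℝ) :
    ∑ u, ∑ v, (if u = a ∧ v = b then (1 : ℝ) else 0) * c u v = c a b := by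
  simp [ite_and]

/-- A transshipment can be replaced, without increasing its cost, by one in which no point both
receives and sends mass. -/
lemma exists_shortcut_free [MetricSpace E] (γ : E → E → ℝ) (hγ : ∀ x y, 0 ≤ γ x y) :
    ∃ g : E → E → ℝ, (∀ x y, 0 ≤ g x y) ∧
      (∀ x, ∑ y, g x y - ∑ y, g y x = ∑ y, γ x y - ∑ y, γ y x) ∧
      ∑ x, ∑ y, g x y * dist x y ≤ ∑ x, ∑ y, γ x y * dist x y ∧
      ∀ x y z, g x y = 0 ∨ g y z = 0 := by
  classical
  -- The bound on total mass makes `S` compact; the cost alone would not, since it ignores the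
  -- diagonal. A minimiser of total mass has no two consecutive arcs: rerouting `x → y → z` as `x →
  -- z` saves mass, and costs no more by the triangle inequality.
  let S : Set (E → E → ℝ) := {g | (∀ x y, 0 ≤ g x y) ∧
      (∀ x, ∑ y, g x y - ∑ y, g y x = ∑ y, γ x y - ∑ y, γ y x) ∧
      ∑ x, ∑ y, g x y * dist x y ≤ ∑ x, ∑ y, γ x y * dist x y ∧
      ∑ x, ∑ y, g x y ≤ ∑ x, ∑ y, γ x y}
  have hclosed : IsClosed S := by
    have h1 : IsClosed {g : E → E → ℝ | ∀ x y, 0 ≤ g x y} := by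
      simp only [Set.ofPred_forall]
      exact isClosed_iInter fun x => isClosed_iInter fun y =>
        isClosed_le continuous_const (by fun_prop)
    have h2 : IsClosed {g : E → E → ℝ |
        ∀ x, ∑ y, g x y - ∑ y, g y x = ∑ y, γ x y - ∑ y, γ y x} := by
      simp only [Set.ofPred_forall]
      exact isClosed_iInter fun x => isClosed_eq (by fun_prop) continuous_const
    have h3 : IsClosed {g : E → E → ℝ |
        ∑ x, ∑ y, g x y * dist x y ≤ ∑ x, ∑ y, γ x y * dist x y} :=
      isClosed_le (by fun_prop) continuous_const
    have h4 : IsClosed {g : E → E → ℝ | ∑ x, ∑ y, g x y ≤ ∑ x, ∑ y, γ x y} :=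
      isClosed_le (by fun_prop) continuous_const
    exact h1.inter (h2.inter (h3.inter h4))
  have hcompact : IsCompact S := by
    refine (isCompact_Icc (a := (0 : E → E → ℝ))
      (b := fun _ _ => ∑ x, ∑ y, γ x y)).of_isClosed_subset hclosed ?_
    rintro g ⟨h0, -, -, h4⟩
    refine ⟨fun x y => h0 x y, fun x y => le_trans ?_ h4⟩
    calc g x y ≤ ∑ y, g x y :=
          Finset.single_le_sum (f := fun y => g x y) (fun y _ => h0 x y) (Finset.mem_univ y)
      _ ≤ ∑ x, ∑ y, g x y :=
          Finset.single_le_sum (f := fun x => ∑ y, g x y)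
            (fun x _ => Finset.sum_nonneg fun y _ => h0 x y) (Finset.mem_univ x)
  obtain ⟨g, ⟨h0, h1, h2, h3⟩, hmin⟩ := hcompact.exists_isMinOn
    (f := fun g : E → E → ℝ => ∑ x, ∑ y, g x y) ⟨γ, hγ, fun _ => rfl, le_rfl, le_rfl⟩
    (by fun_prop)
  refine ⟨g, h0, h1, h2, fun x y z => ?_⟩
  by_contra! hne
  have hp : 0 < g x y := lt_of_le_of_ne (h0 x y) hne.1.symm
  have hq : 0 < g y z := lt_of_le_of_ne (h0 y z) hne.2.symm
  -- The factor `2` covers the case `x = y = z`, where both subtractions hit the same entry.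
  obtain ⟨ε, hε, hεp, hεq⟩ : ∃ ε : ℝ, 0 < ε ∧ 2 * ε ≤ g x y ∧ 2 * ε ≤ g y z :=
    ⟨min (g x y) (g y z) / 2, by positivity, by linarith [min_le_left (g x y) (g y z)],
      by linarith [min_le_right (g x y) (g y z)]⟩
  let e : E → E → E → E → ℝ := fun a b u v => if u = a ∧ v = b then 1 else 0
  have he0 : ∀ a b u v, 0 ≤ e a b u v := fun a b u v => by dsimp [e]; split_ifs <;> norm_num
  have he1 : ∀ a b u v, e a b u v ≤ 1 := fun a b u v => by dsimp [e]; split_ifs <;> norm_num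
  let h : E → E → ℝ := fun u v => g u v - ε * e x y u v - ε * e y z u v + ε * e x z u v
  have hsum : ∀ c : E → E → ℝ, ∑ u, ∑ v, h u v * c u v =
      ∑ u, ∑ v, g u v * c u v - ε * c x y - ε * c y z + ε * c x z := by
    intro c
    have : ∀ a b, ∑ u, ∑ v, e a b u v * c u v = c a b := fun a b => sum_sum_single_mul a b c
    rw [← this x y, ← this y z, ← this x z]
    simp only [h, Finset.mul_sum, ← Finset.sum_sub_distrib, ← Finset.sum_add_distrib]
    exact Finset.sum_congr rfl fun u _ => Finset.sum_congr rfl fun v _ => by ring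
  have hrow : ∀ k : E → E → ℝ, ∀ w, ∑ v, k w v - ∑ v, k v w =
      ∑ u, ∑ v, k u v * ((if u = w then 1 else 0) - (if v = w then 1 else 0)) := by
    intro k w
    simp only [mul_sub, Finset.sum_sub_distrib]
    congr 1
    · rw [Finset.sum_comm]; simp
    · simp
  have hS : h ∈ S := by
    refine ⟨fun u v => ?_, fun w => ?_, ?_, ?_⟩
    · have hxz := mul_nonneg hε.le (he0 x z u v)
      dsimp only [h]
      by_cases h₁ : u = x ∧ v = y
      · obtain ⟨rfl, rfl⟩ := h₁
        have := mul_le_mul_of_nonneg_left (he1 u v u v) hε.le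
        have := mul_le_mul_of_nonneg_left (he1 v z u v) hε.le
        linarith
      · have e1 : e x y u v = 0 := if_neg h₁
        by_cases h₂ : u = y ∧ v = z
        · obtain ⟨rfl, rfl⟩ := h₂
          have := mul_le_mul_of_nonneg_left (he1 u v u v) hε.le
          rw [e1]; linarith
        · have e2 : e y z u v = 0 := if_neg h₂
          rw [e1, e2]; linarith [h0 u v]
    · rw [← h1, hrow, hrow, hsum]
      ring
    · rw [hsum]
      nlinarith [dist_triangle x y z]
    · have := hsum fun _ _ => 1
      simp only [mul_one] at this
      rw [this]; linarith
  have h5 := isMinOn_iff.1 hmin h hS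
  have h6 := hsum fun _ _ => 1
  simp only [mul_one] at h6
  linarith

/-- A transshipment from `a` to `b` yields a transport plan which is at most as expensive. -/
lemma exists_plan_of_transshipment [MetricSpace E] (a b : E → ℝ) (ha : ∀ x, 0 ≤ a x)
    (hb : ∀ x, 0 ≤ b x) (γ : E → E → ℝ) (hγ : ∀ x y, 0 ≤ γ x y)
    (hdiv : ∀ x, ∑ y, γ x y - ∑ y, γ y x = a x - b x) :
    ∃ g : E → E → ℝ, (∀ x y, 0 ≤ g x y) ∧ (∀ x, ∑ y, g x y = a x) ∧ (∀ y, ∑ x, g x y = b y) ∧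
      ∑ x, ∑ y, g x y * dist x y ≤ ∑ x, ∑ y, γ x y * dist x y := by
  classical
  obtain ⟨g, h0, h1, h2, h3⟩ := exists_shortcut_free γ hγ
  -- A point that sends mass receives none, so its outflow is `a x - b x ≤ a x`. The unused part of
  -- `a x` then stays in place on the diagonal, free of charge.
  have hD : ∀ x, 0 ≤ a x - ∑ y, g x y := by
    intro x
    by_cases h : ∑ y, g x y = 0
    · rw [h, sub_zero]; exact ha x
    · obtain ⟨z, -, hz⟩ := Finset.exists_ne_zero_of_sum_ne_zero h
      have : ∑ y, g y x = 0 :=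
        Finset.sum_eq_zero fun y _ => (h3 y x z).resolve_right hz
      have := h1 x
      have := hdiv x
      linarith [hb x]
  refine ⟨fun x y => g x y + if x = y then a x - ∑ z, g x z else 0, fun x y => ?_, fun x => ?_,
    fun y => ?_, ?_⟩
  · have := h0 x y
    dsimp only
    split_ifs
    · linarith [hD x]
    · linarith
  · simp [Finset.sum_add_distrib]
  · simp only [Finset.sum_add_distrib, Finset.sum_ite_eq', Finset.mem_univ, if_true]
    linarith [h1 y, hdiv y]
  · refine le_trans (le_of_eq ?_) h2
    refine Finset.sum_congr rfl fun x _ => Finset.sum_congr rfl fun y _ => ?_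
    dsimp only
    split_ifs with h
    · simp [h]
    · simp

variable [MetricSpace E] [MeasurableSpace E] [MeasurableSingletonClass E]

/-- Only the divergence of `γ` is prescribed, not its marginals, so mass may pass through
intermediate points. Both constructions for the upper bounds, smoothing followed by repair and edge
flows, are of this kind. -/
lemma wassersteinDist_le_of_transshipment (m₁ m₂ : Measure E) [IsFiniteMeasure m₁]
    [IsFiniteMeasure m₂] (γ : E → E → ℝ) (hγ : ∀ x y, 0 ≤ γ x y)
    (hdiv : ∀ x, ∑ y, γ x y - ∑ y, γ y x = m₁.real {x} - m₂.real {x}) :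
    wassersteinDist m₁ m₂ ≤ ENNReal.ofReal (∑ x, ∑ y, γ x y * dist x y) := by
  classical
  obtain ⟨g, h0, hrow, hcol, hcost⟩ := exists_plan_of_transshipment (fun x => m₁.real {x})
    (fun x => m₂.real {x}) (fun _ => measureReal_nonneg) (fun _ => measureReal_nonneg) γ hγ hdiv
  let π : Measure (E × E) := ∑ p : E × E, ENNReal.ofReal (g p.1 p.2) • Measure.dirac p
  have hπ : π ∈ couplings m₁ m₂ := by
    constructor
    · refine Measure.ext_of_singleton fun x => ?_
      rw [Measure.map_apply measurable_fst (measurableSet_singleton x)]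
      simp only [π, Measure.finsetSum_apply, Measure.smul_apply, smul_eq_mul]
      rw [Fintype.sum_prod_type]
      have : ∀ u v : E, ENNReal.ofReal (g u v) * Measure.dirac (u, v) (Prod.fst ⁻¹' {x}) =
          if u = x then ENNReal.ofReal (g u v) else 0 := by
        intro u v
        rw [Measure.dirac_apply' _ (measurable_fst (measurableSet_singleton x))]
        by_cases h : u = x <;> simp [h]
      simp only [this]
      rw [Finset.sum_comm]
      simp only [Finset.sum_ite_eq', Finset.mem_univ, if_true]
      rw [← ENNReal.ofReal_sum_of_nonneg fun y _ => h0 x y, hrow, ofReal_measureReal]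
    · refine Measure.ext_of_singleton fun y => ?_
      rw [Measure.map_apply measurable_snd (measurableSet_singleton y)]
      simp only [π, Measure.finsetSum_apply, Measure.smul_apply, smul_eq_mul]
      rw [Fintype.sum_prod_type]
      have : ∀ u v : E, ENNReal.ofReal (g u v) * Measure.dirac (u, v) (Prod.snd ⁻¹' {y}) =
          if v = y then ENNReal.ofReal (g u v) else 0 := by
        intro u v
        rw [Measure.dirac_apply' _ (measurable_snd (measurableSet_singleton y))]
        by_cases h : v = y <;> simp [h]
      simp only [this]
      simp only [Finset.sum_ite_eq', Finset.mem_univ, if_true]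
      rw [← ENNReal.ofReal_sum_of_nonneg fun x _ => h0 x y, hcol, ofReal_measureReal]
  refine (iInf₂_le π hπ).trans ?_
  refine le_trans (le_of_eq ?_) (ENNReal.ofReal_le_ofReal hcost)
  simp only [π, lintegral_finsetSum_measure, lintegral_smul_measure, lintegral_dirac, smul_eq_mul]
  rw [Fintype.sum_prod_type, ENNReal.ofReal_sum_of_nonneg
    fun x _ => Finset.sum_nonneg fun y _ => mul_nonneg (h0 x y) dist_nonneg]
  refine Finset.sum_congr rfl fun x _ => ?_
  rw [ENNReal.ofReal_sum_of_nonneg fun y _ => mul_nonneg (h0 x y) dist_nonneg]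
  refine Finset.sum_congr rfl fun y _ => ?_
  rw [ENNReal.ofReal_mul (h0 x y), edist_dist]

/-- Two measures of equal mass on a finite metric space have finite Wasserstein distance. -/
lemma wassersteinDist_ne_top (m₁ m₂ : Measure E) [IsProbabilityMeasure m₁]
    [IsProbabilityMeasure m₂] : wassersteinDist m₁ m₂ ≠ ⊤ := by
  have h1 : ∀ (m : Measure E) [IsProbabilityMeasure m], ∑ x, m.real {x} = 1 := fun m _ => by
    rw [sum_measureReal_singleton, Finset.coe_univ, probReal_univ]
  refine ne_top_of_le_ne_top ENNReal.ofReal_ne_top (wassersteinDist_le_of_transshipment m₁ m₂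
    (fun x y => m₁.real {x} * m₂.real {y})
    (fun x y => mul_nonneg measureReal_nonneg measureReal_nonneg) fun x => ?_)
  rw [← Finset.mul_sum, ← Finset.sum_mul, h1, h1]
  ring

/-- Weak Kantorovich duality. -/
lemma le_toReal_wassersteinDist (m₁ m₂ : Measure E) [IsProbabilityMeasure m₁]
    [IsProbabilityMeasure m₂] (f g : E → ℝ) (hfg : ∀ x y, f x + g y ≤ dist x y) :
    ∑ x, m₁.real {x} * f x + ∑ y, m₂.real {y} * g y ≤ (wassersteinDist m₁ m₂).toReal := by
  -- Finiteness is essential here: `toReal` would turn an infinite distance into `0`.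
  rw [← ENNReal.ofReal_le_iff_le_toReal (wassersteinDist_ne_top m₁ m₂)]
  refine le_iInf₂ fun γ hγ => ?_
  obtain ⟨rfl, rfl⟩ := hγ
  have : IsProbabilityMeasure γ :=
    Measure.isProbabilityMeasure_of_map (μ := γ) (f := Prod.fst)
  have e1 : ∑ x, (γ.map Prod.fst).real {x} * f x = ∫ p, f p.1 ∂γ := by
    rw [← integral_map (φ := Prod.fst) (f := f) (by fun_prop)
      (Measurable.of_discrete.aestronglyMeasurable), integral_fintype (.of_finite)]
    rfl
  have e2 : ∑ x, (γ.map Prod.snd).real {x} * g x = ∫ p, g p.2 ∂γ := by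
    rw [← integral_map (φ := Prod.snd) (f := g) (by fun_prop)
      (Measurable.of_discrete.aestronglyMeasurable), integral_fintype (.of_finite)]
    rfl
  rw [e1, e2, ← integral_add .of_finite .of_finite]
  calc ENNReal.ofReal (∫ p, (f p.1 + g p.2) ∂γ) ≤ ENNReal.ofReal (∫ p, dist p.1 p.2 ∂γ) :=
        ENNReal.ofReal_le_ofReal (integral_mono .of_finite .of_finite fun p => hfg p.1 p.2)
    _ = ∫⁻ p, edist p.1 p.2 ∂γ := by
        rw [ofReal_integral_eq_lintegral_ofReal .of_finite (.of_forall fun _ => dist_nonneg)]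
        simp [edist_dist]

end Transport

/-! ### The uniform measure on the cube and its samples -/

section Sample

variable {n N : ℕ}

lemma card_boolCube (n : ℕ) : Fintype.card (BoolCube n) = 2 ^ n := by
  have : Fintype.card (Fin n → ℤˣ) = 2 ^ n := by simp
  exact this

lemma cubeUniform_singleton (x : BoolCube n) : cubeUniform n {x} = ((2 : ℝ≥0∞) ^ n)⁻¹ := by
  simp [cubeUniform]

lemma cubeUniform_real_singleton (x : BoolCube n) :
    (cubeUniform n).real {x} = ((2 : ℝ) ^ n)⁻¹ := by
  simp [Measure.real, cubeUniform_singleton]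

instance instIsProbabilityMeasureCubeUniform (n : ℕ) : IsProbabilityMeasure (cubeUniform n) := by
  constructor
  have h : (Measure.count : Measure (BoolCube n)) Set.univ = 2 ^ n := by
    rw [← Finset.coe_univ, Measure.count_apply_finset, Finset.card_univ, card_boolCube]
    simp
  rw [cubeUniform, Measure.smul_apply, h, smul_eq_mul]
  exact ENNReal.inv_mul_cancel (by simp) (by simp)

lemma integral_cubeUniform (g : BoolCube n → ℝ) :
    ∫ x, g x ∂(cubeUniform n) = (∑ x, g x) / 2 ^ n := by
  rw [integral_fintype .of_finite, Finset.sum_div]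
  refine Finset.sum_congr rfl fun x _ => ?_
  rw [cubeUniform_real_singleton, smul_eq_mul]
  ring

/-- The law of `N` independent uniform points of the cube. -/
noncomputable abbrev sampleLaw (n N : ℕ) : Measure (Fin N → BoolCube n) := Measure.pi fun _ => cubeUniform n

lemma sampleLaw_real_singleton (x : Fin N → BoolCube n) :
    (sampleLaw n N).real {x} = (((2 : ℝ) ^ n) ^ N)⁻¹ := by
  simp [Measure.real, cubeUniform_singleton]

lemma integral_sampleLaw (F : (Fin N → BoolCube n) → ℝ) :
    ∫ x, F x ∂(sampleLaw n N) = (∑ x, F x) / ((2 : ℝ) ^ n) ^ N := by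
  rw [integral_fintype .of_finite, Finset.sum_div]
  refine Finset.sum_congr rfl fun x _ => ?_
  rw [sampleLaw_real_singleton, smul_eq_mul]
  ring

/-- The expectation depends only on the joint law of the sample, which independence makes a product;
the probability spaces disappear from here on. -/
lemma meanMatchingDist_eq {Ω : Type*} [MeasurableSpace Ω] (P : Measure Ω) [IsProbabilityMeasure P]
    (X : Fin N → Ω → BoolCube n) (hindep : iIndepFun X P)
    (hlaw : ∀ i, HasLaw (X i) (cubeUniform n) P) :
    meanMatchingDist P X =
      ∫ x, (wassersteinDist (empiricalMeasure x) (cubeUniform n)).toReal ∂(sampleLaw n N) := by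
  have h := (iIndepFun_iff_map_fun_eq_pi_map fun i => (hlaw i).aemeasurable).1 hindep
  simp only [fun i => (hlaw i).map_eq] at h
  rw [sampleLaw, ← h, integral_map (aemeasurable_pi_lambda _ fun i => (hlaw i).aemeasurable)
    Measurable.of_discrete.aestronglyMeasurable]
  rfl

instance instIsProbabilityMeasureEmpiricalMeasure {E : Type*} [MeasurableSpace E] [NeZero N]
    (x : Fin N → E) : IsProbabilityMeasure (empiricalMeasure x) := by
  constructor
  simp only [empiricalMeasure, Measure.smul_apply, Measure.finsetSum_apply, measure_univ,
    Finset.sum_const, Finset.card_univ, Fintype.card_fin, smul_eq_mul, nsmul_eq_mul, mul_one]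
  exact ENNReal.inv_mul_cancel (by simpa using NeZero.ne N) (by simp)

lemma empiricalMeasure_real_singleton (x : Fin N → BoolCube n) (z : BoolCube n) :
    (empiricalMeasure x).real {z} = (∑ j, if x j = z then (1 : ℝ) else 0) / N := by
  classical
  have : ∀ j, Measure.dirac (x j) {z} = if x j = z then (1 : ℝ≥0∞) else 0 := fun j => by
    rw [Measure.dirac_apply]
    by_cases h : x j = z <;> simp [h]
  simp only [Measure.real, empiricalMeasure, Measure.smul_apply, Measure.finsetSum_apply, this,
    smul_eq_mul, ENNReal.toReal_mul, ENNReal.toReal_inv, ENNReal.toReal_natCast]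
  rw [ENNReal.toReal_sum fun j _ => by split_ifs <;> simp]
  rw [div_eq_inv_mul]
  congr 1
  refine Finset.sum_congr rfl fun j _ => ?_
  split_ifs <;> simp

/-- The mean deviation of an empirical average is at most its standard deviation. -/
lemma integral_abs_average_sub_le [NeZero N] (g : BoolCube n → ℝ) :
    ∫ x, |(∑ j, g (x j)) / N - (∑ y, g y) / 2 ^ n| ∂(sampleLaw n N) ≤
      √((∑ y, g y ^ 2) / 2 ^ n / N) := by
  have hN : (N : ℝ) ≠ 0 := by exact_mod_cast NeZero.ne N
  have hvar : Var[∑ j, fun x : Fin N → BoolCube n => g (x j); sampleLaw n N] ≤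
      N * ((∑ y, g y ^ 2) / 2 ^ n) := by
    rw [variance_sum_pi fun _ => .of_discrete]
    calc ∑ _j : Fin N, Var[g; cubeUniform n] ≤ ∑ _j : Fin N, (∑ y, g y ^ 2) / 2 ^ n := by
          refine Finset.sum_le_sum fun j _ => ?_
          refine (variance_le_expectation_sq Measurable.of_discrete.aestronglyMeasurable).trans ?_
          rw [integral_cubeUniform]
          rfl
      _ = _ := by simp
  have hmean : ∫ x, (∑ j, fun x : Fin N → BoolCube n => g (x j)) x ∂(sampleLaw n N) =
      N * ((∑ y, g y) / 2 ^ n) := by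
    simp only [Finset.sum_apply]
    rw [integral_finsetSum _ fun _ _ => .of_finite]
    simp only [integral_comp_eval (μ := fun _ : Fin N => cubeUniform n)
      (Measurable.of_discrete.aestronglyMeasurable (f := g)), integral_cubeUniform]
    simp
  refine Real.le_sqrt_of_sq_le ?_
  calc (∫ x, |(∑ j, g (x j)) / N - (∑ y, g y) / 2 ^ n| ∂(sampleLaw n N)) ^ 2
      ≤ ∫ x, |(∑ j, g (x j)) / N - (∑ y, g y) / 2 ^ n| ^ 2 ∂(sampleLaw n N) :=
        (even_two.convexOn_pow).map_integral_le (continuous_pow 2).continuousOn isClosed_univ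
          (by simp) .of_finite .of_finite
    _ = (N : ℝ)⁻¹ ^ 2 * Var[∑ j, fun x : Fin N → BoolCube n => g (x j); sampleLaw n N] := by
        rw [variance_eq_integral Measurable.of_discrete.aemeasurable, hmean,
          ← integral_const_mul]
        refine integral_congr_ae (.of_forall fun x => ?_)
        simp only [sq_abs, Finset.sum_apply]
        field_simp
    _ ≤ (N : ℝ)⁻¹ ^ 2 * (N * ((∑ y, g y ^ 2) / 2 ^ n)) := by gcongr
    _ = _ := by field_simp

/-- Summing over samples a function of the number of sample points equal to `z`. -/
lemma sum_comp_count {E : Type*} [Fintype E] [DecidableEq E] (z : E) (F : ℕ → ℝ) :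
    ∑ x : Fin N → E, F (Finset.univ.filter fun j => x j = z).card =
      ∑ k ∈ Finset.range (N + 1), N.choose k * ((Fintype.card E - 1 : ℕ) : ℝ) ^ (N - k) * F k := by
  classical
  rw [← Finset.sum_fiberwise (s := Finset.univ)
    (g := fun x : Fin N → E => Finset.univ.filter fun j => x j = z)]
  -- Group the samples by the set `A` of indices that hit `z`; each of the other `N - A.card`
  -- entries avoids `z` freely.
  have hfib : ∀ A : Finset (Fin N),
      ∑ x : Fin N → E with (Finset.univ.filter fun j => x j = z) = A,
        F (Finset.univ.filter fun j => x j = z).card =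
      ((Fintype.card E - 1 : ℕ) : ℝ) ^ (N - A.card) * F A.card := by
    intro A
    have hset : (Finset.univ.filter fun x : Fin N → E =>
        (Finset.univ.filter fun j => x j = z) = A) =
        Fintype.piFinset fun j => if j ∈ A then {z} else Finset.univ.erase z := by
      ext x
      simp only [Finset.mem_filter, Finset.mem_univ, true_and, Fintype.mem_piFinset,
        Finset.ext_iff]
      refine forall_congr' fun j => ?_
      by_cases h : j ∈ A <;> simp [h]
    have hcard : ((Finset.univ.filter fun x : Fin N → E =>
        (Finset.univ.filter fun j => x j = z) = A).card : ℝ) =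
        ((Fintype.card E - 1 : ℕ) : ℝ) ^ (N - A.card) := by
      rw [hset, Fintype.card_piFinset]
      simp only [apply_ite Finset.card, Finset.card_singleton, Finset.card_erase_of_mem
        (Finset.mem_univ z), Finset.card_univ]
      rw [Finset.prod_ite, Finset.prod_const_one, one_mul, Finset.prod_const,
        Finset.filter_not, Finset.card_sdiff_of_subset (Finset.filter_subset _ _)]
      simp
    rw [← hcard, ← nsmul_eq_mul, ← Finset.sum_const]
    refine Finset.sum_congr rfl fun x hx => ?_
    rw [(Finset.mem_filter.1 hx).2]
  simp only [hfib]
  rw [← Finset.powerset_univ, Finset.sum_powerset_apply_card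
    (fun k => ((Fintype.card E - 1 : ℕ) : ℝ) ^ (N - k) * F k)]
  simp [mul_assoc]

/-- The number of sample points equal to a given point has a binomial law. -/
lemma integral_sampleLaw_count (z : BoolCube n) (F : ℕ → ℝ) :
    ∫ x, F (Finset.univ.filter fun j => x j = z).card ∂(sampleLaw n N) =
      ∑ k ∈ Finset.range (N + 1),
        N.choose k * ((2 : ℝ) ^ n)⁻¹ ^ k * (1 - ((2 : ℝ) ^ n)⁻¹) ^ (N - k) * F k := by
  rw [integral_sampleLaw, sum_comp_count, Finset.sum_div]
  refine Finset.sum_congr rfl fun k hk => ?_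
  have hk' : k ≤ N := Nat.lt_succ_iff.1 (Finset.mem_range.1 hk)
  have h2 : (2 : ℝ) ^ n ≠ 0 := by positivity
  rw [card_boolCube, Nat.cast_sub Nat.one_le_two_pow]
  push_cast
  have h3 : (1 - ((2 : ℝ) ^ n)⁻¹) = (2 ^ n - 1) / 2 ^ n := by field_simp
  rw [h3, div_pow, ← Nat.add_sub_of_le hk', Nat.add_sub_cancel_left, pow_add, inv_pow]
  field_simp

/-- The point at which `x` is changed in the coordinates belonging to `A`. -/
def flipSet (x : BoolCube n) (A : Finset (Fin n)) : BoolCube n :=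
  Hamming.toHamming fun i => if i ∈ A then -x i else x i

/-- The number of points at each distance from a point of the cube is a binomial coefficient. -/
lemma sum_comp_hammingDist (x : BoolCube n) (F : ℕ → ℝ) :
    ∑ y : BoolCube n, F (hammingDist (Hamming.ofHamming x) (Hamming.ofHamming y)) =
      ∑ k ∈ Finset.range (n + 1), n.choose k * F k := by
  have h := Finset.sum_powerset_apply_card F (x := (Finset.univ : Finset (Fin n)))
  simp only [Finset.powerset_univ, Finset.card_univ, Fintype.card_fin, nsmul_eq_mul] at h
  rw [← h]
  refine (Fintype.sum_bijective (fun y : BoolCube n =>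
      Finset.univ.filter fun i => Hamming.ofHamming x i ≠ Hamming.ofHamming y i)
    (Function.bijective_iff_has_inverse.2 ⟨flipSet x, fun y => ?_, fun A => ?_⟩) _ _
    fun y => rfl)
  · funext i
    have h : ∀ a b : ℤˣ, (if a ≠ b then -a else a) = b := by decide
    have := h (x i) (y i)
    simp only [flipSet, Finset.mem_filter, Finset.mem_univ, true_and]
    exact this
  · ext i
    have h : ∀ a : ℤˣ, a ≠ -a ∧ ¬ a ≠ a := by decide
    simp only [Finset.mem_filter, Finset.mem_univ, true_and]
    change x i ≠ (if i ∈ A then -x i else x i) ↔ i ∈ A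
    split_ifs with hA
    · exact iff_of_true (h (x i)).1 hA
    · exact iff_of_false (h (x i)).2 hA

end Sample

/-! ### Bounds for a fixed dimension and sample size -/

section Bounds

variable {n N : ℕ}

/-- The mean Wasserstein distance between the empirical measure of `N` independent uniform points
and the uniform measure. -/
noncomputable def meanCubeDist (n N : ℕ) : ℝ :=
  ∫ x, (wassersteinDist (empiricalMeasure x) (cubeUniform n)).toReal ∂(sampleLaw n N)

lemma sum_choose_mul_cast (n : ℕ) :
    ∑ k ∈ Finset.range (n + 1), (n.choose k : ℝ) * k = n / 2 * 2 ^ n := by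
  have h := Finset.sum_range_reflect (fun k => (n.choose k : ℝ) * k) (n + 1)
  have h2 : ∑ k ∈ Finset.range (n + 1), ((n.choose k : ℝ) * k +
      (n.choose (n + 1 - 1 - k) : ℝ) * ((n + 1 - 1 - k : ℕ) : ℝ)) = n * 2 ^ n := by
    have h3 : ∑ k ∈ Finset.range (n + 1), (n.choose k : ℝ) = 2 ^ n := by
      exact_mod_cast Nat.sum_range_choose n
    rw [← h3, Finset.mul_sum]
    refine Finset.sum_congr rfl fun k hk => ?_
    have hk' : k ≤ n := Nat.lt_succ_iff.1 (Finset.mem_range.1 hk)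
    rw [Nat.add_sub_cancel, Nat.choose_symm hk', Nat.cast_sub hk']
    ring
  rw [Finset.sum_add_distrib, h] at h2
  linarith

lemma sum_dist_right (u : BoolCube n) : ∑ v, dist u v = n / 2 * 2 ^ n := by
  rw [← sum_choose_mul_cast, ← sum_comp_hammingDist u fun k => (k : ℝ)]
  rfl

lemma sum_dist_left (v : BoolCube n) : ∑ u, dist u v = n / 2 * 2 ^ n := by
  simp only [dist_comm _ v, sum_dist_right]

lemma sum_empiricalMeasure_mul (x : Fin N → BoolCube n) (g : BoolCube n → ℝ) :
    ∑ u, (empiricalMeasure x).real {u} * g u = (∑ j, g (x j)) / N := by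
  simp only [empiricalMeasure_real_singleton, div_mul_eq_mul_div, ← Finset.sum_div]
  congr 1
  simp only [Finset.sum_mul]
  rw [Finset.sum_comm]
  simp

/-- Smoothing the empirical measure by a radial kernel `ψ`. -/
lemma toReal_wassersteinDist_le_smoothing [NeZero N] (ψ : ℕ → ℝ) (hψ : ∀ k, 0 ≤ ψ k)
    (hsum : ∑ k ∈ Finset.range (n + 1), n.choose k * ψ k = 1) (x : Fin N → BoolCube n) :
    (wassersteinDist (empiricalMeasure x) (cubeUniform n)).toReal ≤
      ∑ k ∈ Finset.range (n + 1), n.choose k * (ψ k * k) + n / 2 *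
        ∑ v, |(∑ j, ψ (hammingDist (Hamming.ofHamming (x j)) (Hamming.ofHamming v))) / N -
          ((2 : ℝ) ^ n)⁻¹| := by
  let a : BoolCube n → ℝ := fun u => (empiricalMeasure x).real {u}
  let K : BoolCube n → BoolCube n → ℝ :=
    fun u v => ψ (hammingDist (Hamming.ofHamming u) (Hamming.ofHamming v))
  let D : BoolCube n → ℝ := fun v => (∑ j, K (x j) v) / N - ((2 : ℝ) ^ n)⁻¹
  have ha : ∑ u, a u = 1 := by
    rw [sum_measureReal_singleton, Finset.coe_univ, probReal_univ]
  have hK : ∀ u, ∑ v, K u v = 1 := fun u => (sum_comp_hammingDist u ψ).trans hsum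
  have haK : ∀ v, ∑ u, a u * K u v = D v + ((2 : ℝ) ^ n)⁻¹ := fun v => by
    rw [sum_empiricalMeasure_mul x fun u => K u v]
    simp [D]
  have h2 : (2 : ℝ) ^ n * ((2 : ℝ) ^ n)⁻¹ = 1 := mul_inv_cancel₀ (by positivity)
  have hcard : ((Finset.univ : Finset (BoolCube n)).card : ℝ) = 2 ^ n := by
    rw [Finset.card_univ, card_boolCube]; simp
  have hD : ∑ v, D v = 0 := by
    have h1 : ∑ v, ∑ u, a u * K u v = 1 := by
      rw [Finset.sum_comm]
      simp only [← Finset.mul_sum, hK, mul_one, ha]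
    simp only [haK, Finset.sum_add_distrib, Finset.sum_const, nsmul_eq_mul, hcard, h2] at h1
    linarith
  -- The kernel turns `a` into the uniform weights plus `D`. To cancel `D`, its positive part is
  -- spread uniformly over the cube and its negative part is collected uniformly from the cube. Both
  -- steps cover the mean distance `n / 2`, and each moves mass `∑ |D| / 2`.
  let γ : BoolCube n → BoolCube n → ℝ := fun u v =>
    a u * K u v + ((2 : ℝ) ^ n)⁻¹ * ((|D u| + D u) / 2 + (|D v| - D v) / 2)
  have hγ : ∀ u v, 0 ≤ γ u v := by
    intro u v
    have h1 : 0 ≤ a u * K u v := mul_nonneg measureReal_nonneg (hψ _)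
    have h3 : 0 ≤ (|D u| + D u) / 2 + (|D v| - D v) / 2 := by
      linarith [neg_abs_le (D u), le_abs_self (D v)]
    positivity
  have hdiv : ∀ u, ∑ v, γ u v - ∑ v, γ v u = a u - (cubeUniform n).real {u} := by
    intro u
    rw [cubeUniform_real_singleton]
    simp only [γ, Finset.sum_add_distrib, ← Finset.mul_sum, hK, haK, Finset.sum_const,
      nsmul_eq_mul, hcard, ← Finset.sum_div, Finset.sum_sub_distrib, hD]
    linear_combination D u * h2
  have hle := wassersteinDist_le_of_transshipment _ _ γ hγ hdiv
  have hcost : ∑ u, ∑ v, γ u v * dist u v =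
      ∑ k ∈ Finset.range (n + 1), n.choose k * (ψ k * k) + n / 2 * ∑ v, |D v| := by
    have e1 : ∑ u, ∑ v, a u * K u v * dist u v =
        ∑ k ∈ Finset.range (n + 1), n.choose k * (ψ k * k) := by
      simp only [mul_assoc, ← Finset.mul_sum]
      have : ∀ u, ∑ v, K u v * dist u v =
          ∑ k ∈ Finset.range (n + 1), n.choose k * (ψ k * k) := fun u =>
        sum_comp_hammingDist u fun k => ψ k * k
      simp only [this, ← Finset.sum_mul, ha, one_mul]
    have e2 : ∑ u, ∑ v, ((|D u| + D u) / 2) * dist u v =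
        n / 2 * 2 ^ n * ((∑ v, |D v|) / 2) := by
      simp only [← Finset.mul_sum, sum_dist_right, ← Finset.sum_mul, ← Finset.sum_div,
        Finset.sum_add_distrib, hD]
      ring
    have e3 : ∑ u, ∑ v, ((|D v| - D v) / 2) * dist u v =
        n / 2 * 2 ^ n * ((∑ v, |D v|) / 2) := by
      rw [Finset.sum_comm]
      simp only [← Finset.mul_sum, sum_dist_left, ← Finset.sum_mul, ← Finset.sum_div,
        Finset.sum_sub_distrib, hD]
      ring
    simp only [γ, add_mul, mul_add, mul_assoc, Finset.sum_add_distrib, ← Finset.mul_sum]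
      at e1 e2 e3 ⊢
    rw [e1, e2, e3]
    linear_combination (n / 2 * (∑ v, |D v|)) * h2
  rw [hcost] at hle
  refine ENNReal.toReal_le_of_le_ofReal ?_ hle
  have : ∀ k, 0 ≤ ψ k := hψ
  exact add_nonneg (Finset.sum_nonneg fun k _ => by have := hψ k; positivity)
    (by positivity)

/-- At a fixed point the smoothed mass is an average of `N` independent terms with mean `2⁻ⁿ`, so
its mean deviation is at most a standard deviation. As the kernel is radial, the resulting bound is
the same at all `2 ^ n` points. -/
lemma meanCubeDist_le_of_radial [NeZero N] (ψ : ℕ → ℝ) (hψ : ∀ k, 0 ≤ ψ k)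
    (hsum : ∑ k ∈ Finset.range (n + 1), n.choose k * ψ k = 1) :
    meanCubeDist n N ≤ ∑ k ∈ Finset.range (n + 1), n.choose k * (ψ k * k) +
      n / 2 * √(2 ^ n * (∑ k ∈ Finset.range (n + 1), n.choose k * ψ k ^ 2) / N) := by
  let K : BoolCube n → BoolCube n → ℝ :=
    fun v u => ψ (hammingDist (Hamming.ofHamming u) (Hamming.ofHamming v))
  have hK : ∀ (F : ℕ → ℝ) (v : BoolCube n),
      ∑ u : BoolCube n, F (hammingDist (Hamming.ofHamming u) (Hamming.ofHamming v)) =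
        ∑ k ∈ Finset.range (n + 1), n.choose k * F k := by
    intro F v
    rw [← sum_comp_hammingDist v]
    exact Finset.sum_congr rfl fun u _ => by rw [hammingDist_comm]
  have hmean : ∀ v, (∑ u, K v u) / 2 ^ n = ((2 : ℝ) ^ n)⁻¹ := fun v => by
    rw [show ∑ u, K v u = 1 from (hK ψ v).trans hsum, one_div]
  have hsq : ∀ v, ∑ u, K v u ^ 2 = ∑ k ∈ Finset.range (n + 1), n.choose k * ψ k ^ 2 :=
    hK fun k => ψ k ^ 2
  have h2 : (0 : ℝ) < 2 ^ n := by positivity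
  calc meanCubeDist n N
      ≤ ∫ x, (∑ k ∈ Finset.range (n + 1), n.choose k * (ψ k * k) + n / 2 *
          ∑ v, |(∑ j, K v (x j)) / N - ((2 : ℝ) ^ n)⁻¹|) ∂(sampleLaw n N) :=
        integral_mono .of_finite .of_finite
          fun x => toReal_wassersteinDist_le_smoothing ψ hψ hsum x
    _ = ∑ k ∈ Finset.range (n + 1), n.choose k * (ψ k * k) + n / 2 *
          ∑ v, ∫ x, |(∑ j, K v (x j)) / N - ((2 : ℝ) ^ n)⁻¹| ∂(sampleLaw n N) := by
        rw [integral_add .of_finite .of_finite, integral_const_mul, integral_const,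
          integral_finsetSum _ fun _ _ => .of_finite, probReal_univ, one_smul]
    _ ≤ ∑ k ∈ Finset.range (n + 1), n.choose k * (ψ k * k) + n / 2 *
          ∑ _v : BoolCube n,
            √((∑ k ∈ Finset.range (n + 1), n.choose k * ψ k ^ 2) / 2 ^ n / N) := by
        gcongr with v _
        rw [← hsq v, ← hmean v]
        exact integral_abs_average_sub_le (K v)
    _ = _ := by
        rw [Finset.sum_const, Finset.card_univ, card_boolCube, nsmul_eq_mul, Nat.cast_pow,
          Nat.cast_ofNat]
        nth_rewrite 1 [← Real.sqrt_sq h2.le]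
        rw [← Real.sqrt_mul (by positivity)]
        congr 3
        field_simp

/-- No point of the cube outside the balls of radius `κ` around the sample can be served at a
cost lower than `κ`. -/
lemma le_meanCubeDist_of_ball [NeZero N] (κ θ : ℝ) (hκ : 0 ≤ κ) (hθ : 0 < θ) (hθ1 : θ ≤ 1) :
    κ * (1 - N * ((1 + θ) ^ n * θ ^ (-κ) / 2 ^ n)) ≤ meanCubeDist n N := by
  classical
  have hpoint : ∀ x : Fin N → BoolCube n, κ * (1 - N * ((1 + θ) ^ n * θ ^ (-κ) / 2 ^ n)) ≤
      (wassersteinDist (empiricalMeasure x) (cubeUniform n)).toReal := by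
    intro x
    -- The potential `-κ` off the sample makes the dual constraint trivial there and costs nothing,
    -- since the empirical measure does not charge those points.
    refine le_trans ?_ (le_toReal_wassersteinDist _ _
      (fun u => if ∃ j, x j = u then 0 else -κ)
      (fun v => if ∀ j, κ ≤ dist (x j) v then κ else 0) fun u v => ?_)
    · rw [sum_empiricalMeasure_mul]
      -- Chernoff: the indicator of a ball is at most `θ ^ (dist - κ)`, whose sum over the cube is
      -- explicit by the binomial theorem.
      have h1 : ∀ v, κ * (1 - ∑ j, θ ^ (-κ) * θ ^ (hammingDist (Hamming.ofHamming (x j))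
          (Hamming.ofHamming v))) ≤ if ∀ j, κ ≤ dist (x j) v then κ else 0 := by
        intro v
        have hnn : ∀ j, 0 ≤ θ ^ (-κ) * θ ^ (hammingDist (Hamming.ofHamming (x j))
          (Hamming.ofHamming v)) := fun j => by positivity
        split_ifs with h
        · have := Finset.sum_nonneg fun j (_ : j ∈ Finset.univ) => hnn j
          nlinarith
        · push Not at h
          obtain ⟨j, hj⟩ := h
          have h2 := Finset.single_le_sum (fun j _ => hnn j) (Finset.mem_univ j)
          have h3 : 1 ≤ θ ^ (-κ) * θ ^ (hammingDist (Hamming.ofHamming (x j))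
              (Hamming.ofHamming v)) := by
            rw [← Real.rpow_natCast, ← Real.rpow_add hθ]
            refine Real.one_le_rpow_of_pos_of_le_one_of_nonpos hθ hθ1 ?_
            have : dist (x j) v = hammingDist (Hamming.ofHamming (x j)) (Hamming.ofHamming v) :=
              rfl
            linarith
          nlinarith
      have h2 : (2 : ℝ) ^ n ≠ 0 := by positivity
      have hN : (N : ℝ) ≠ 0 := by exact_mod_cast NeZero.ne N
      calc κ * (1 - N * ((1 + θ) ^ n * θ ^ (-κ) / 2 ^ n))
          = ∑ v : BoolCube n, ((2 : ℝ) ^ n)⁻¹ * (κ * (1 - ∑ j, θ ^ (-κ) *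
              θ ^ (hammingDist (Hamming.ofHamming (x j)) (Hamming.ofHamming v)))) := by
            rw [← Finset.mul_sum, ← Finset.mul_sum, Finset.sum_sub_distrib, Finset.sum_comm]
            simp only [← Finset.mul_sum, sum_comp_hammingDist _ fun k => θ ^ k]
            have : ∑ k ∈ Finset.range (n + 1), (n.choose k : ℝ) * θ ^ k = (1 + θ) ^ n := by
              rw [add_comm 1 θ, add_pow]
              exact Finset.sum_congr rfl fun k _ => by ring
            rw [this]
            simp only [Finset.sum_const, Finset.card_univ, card_boolCube, nsmul_eq_mul,
              Fintype.card_fin]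
            push_cast
            field_simp
        _ ≤ ∑ v : BoolCube n, ((2 : ℝ) ^ n)⁻¹ * (if ∀ j, κ ≤ dist (x j) v then κ else 0) := by
            gcongr with v _
            exact h1 v
        _ ≤ _ := by simp [cubeUniform_real_singleton]
    · by_cases hu : ∃ j, x j = u
      · rw [if_pos hu, zero_add]
        obtain ⟨j, rfl⟩ := hu
        split_ifs with h
        · exact h j
        · exact dist_nonneg
      · rw [if_neg hu]
        refine le_trans ?_ dist_nonneg
        split_ifs <;> linarith
  calc κ * (1 - N * ((1 + θ) ^ n * θ ^ (-κ) / 2 ^ n))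
      = ∫ _x, κ * (1 - N * ((1 + θ) ^ n * θ ^ (-κ) / 2 ^ n)) ∂(sampleLaw n N) := by simp
    _ ≤ _ := integral_mono .of_finite .of_finite hpoint

/-- Any mass that has to be moved is moved by a distance at least `1`. -/
lemma sum_deficit_le_toReal_wassersteinDist [NeZero N] (x : Fin N → BoolCube n) :
    ∑ v, max 0 (((2 : ℝ) ^ n)⁻¹ - (Finset.univ.filter fun j => x j = v).card / N) ≤
      (wassersteinDist (empiricalMeasure x) (cubeUniform n)).toReal := by
  classical
  have ha : ∀ v, (empiricalMeasure x).real {v} =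
      ((Finset.univ.filter fun j => x j = v).card : ℝ) / N := fun v => by
    rw [empiricalMeasure_real_singleton]; simp
  -- The potentials are minus and plus the indicator of the underloaded points: they cancel on the
  -- diagonal, and elsewhere sum to at most `1`, the least distance.
  let A : BoolCube n → Prop := fun v => (empiricalMeasure x).real {v} ≤ ((2 : ℝ) ^ n)⁻¹
  refine le_trans (le_of_eq ?_) (le_toReal_wassersteinDist _ _
      (fun u => if A u then -1 else 0) (fun v => if A v then 1 else 0) fun u v => ?_)
  · rw [← Finset.sum_add_distrib]
    refine Finset.sum_congr rfl fun v _ => ?_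
    rw [cubeUniform_real_singleton, ← ha]
    by_cases h : A v
    · rw [if_pos h, if_pos h, max_eq_right (sub_nonneg.2 h)]
      ring
    · rw [if_neg h, if_neg h, max_eq_left (by simp only [A] at h; linarith)]
      ring
  · by_cases h : u = v
    · subst h
      rw [dist_self]
      split_ifs <;> norm_num
    · have h1 : 1 ≤ dist u v := by
        have : 0 < hammingDist (Hamming.ofHamming u) (Hamming.ofHamming v) :=
          hammingDist_pos.2 h
        rw [Hamming.dist_eq_hammingDist]
        exact_mod_cast this
      refine le_trans ?_ h1
      split_ifs <;> norm_num

/-- De Moivre's telescoping of the lower tail of the mean absolute deviation of a binomial law. -/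
lemma sum_range_binomial_deviation (N ν : ℕ) (hν : ν ≤ N) (q : ℝ) :
    ∑ k ∈ Finset.range ν, N.choose k * q ^ k * (1 - q) ^ (N - k) * (N * q - k) =
      ν * N.choose ν * q ^ ν * (1 - q) ^ (N + 1 - ν) := by
  induction ν with
  | zero => simp
  | succ k ih =>
    rw [Finset.sum_range_succ, ih (by omega)]
    obtain ⟨d, rfl⟩ : ∃ d, N = k + 1 + d := ⟨N - (k + 1), by omega⟩
    have hc : (((k + 1 + d).choose (k + 1) : ℕ) : ℝ) * (k + 1) =
        ((k + 1 + d).choose k : ℕ) * (d + 1) := by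
      have := Nat.choose_succ_right_eq (k + 1 + d) k
      rw [show k + 1 + d - k = d + 1 by omega] at this
      exact_mod_cast this
    rw [show k + 1 + d - k = d + 1 by omega, show k + 1 + d + 1 - k = d + 2 by omega,
      show k + 1 + d + 1 - (k + 1) = d + 1 by omega]
    push_cast at hc ⊢
    linear_combination (- q ^ (k + 1) * (1 - q) ^ (d + 1)) * hc

/-- The mean deficit at a point dominates the signed deviation summed over counts below any `ν`, and
this sum telescopes. Nothing is lost for `ν = ⌈N / 2 ^ n⌉`, while `ν = 1` keeps only the event that
the point is missed. -/
lemma le_meanCubeDist_of_deviation [NeZero N] (ν : ℕ) (hν : ν ≤ N) :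
    2 ^ n / N * (ν * N.choose ν * ((2 : ℝ) ^ n)⁻¹ ^ ν * (1 - ((2 : ℝ) ^ n)⁻¹) ^ (N + 1 - ν)) ≤
      meanCubeDist n N := by
  have hN : (0 : ℝ) < N := by exact_mod_cast NeZero.pos N
  set q : ℝ := ((2 : ℝ) ^ n)⁻¹ with hq
  have hq0 : 0 ≤ q := by positivity
  have hq1 : 0 ≤ 1 - q := sub_nonneg.2 (inv_le_one_of_one_le₀ (one_le_pow₀ one_le_two))
  have hterm : ∀ k, 0 ≤ (N.choose k : ℝ) * q ^ k * (1 - q) ^ (N - k) := fun k => by positivity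
  calc 2 ^ n / N * (ν * N.choose ν * q ^ ν * (1 - q) ^ (N + 1 - ν))
      = 2 ^ n * ∑ k ∈ Finset.range ν, N.choose k * q ^ k * (1 - q) ^ (N - k) * (q - k / N) := by
        rw [← sum_range_binomial_deviation N ν hν q, div_mul_eq_mul_div, mul_div_assoc,
          Finset.sum_div]
        congr 1
        refine Finset.sum_congr rfl fun k _ => ?_
        field_simp
    _ ≤ 2 ^ n * ∑ k ∈ Finset.range (N + 1),
          N.choose k * q ^ k * (1 - q) ^ (N - k) * max 0 (q - k / N) := by
        gcongr
        calc ∑ k ∈ Finset.range ν, N.choose k * q ^ k * (1 - q) ^ (N - k) * (q - k / N)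
            ≤ ∑ k ∈ Finset.range ν, N.choose k * q ^ k * (1 - q) ^ (N - k) * max 0 (q - k / N) :=
              Finset.sum_le_sum fun k _ => mul_le_mul_of_nonneg_left (le_max_right _ _) (hterm k)
          _ ≤ _ := Finset.sum_le_sum_of_subset_of_nonneg
              (Finset.range_subset_range.2 (by omega))
              fun k _ _ => mul_nonneg (hterm k) (le_max_left _ _)
    _ = ∫ x, ∑ v : BoolCube n, max 0 (q - (Finset.univ.filter fun j => x j = v).card / N)
          ∂(sampleLaw n N) := by
        rw [integral_finsetSum _ fun _ _ => .of_finite]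
        simp only [fun v => integral_sampleLaw_count (N := N) v fun k => max 0 (q - k / N)]
        simp [card_boolCube, hq]
    _ ≤ _ := integral_mono .of_finite .of_finite sum_deficit_le_toReal_wassersteinDist

end Bounds

/-! ### The flow given by the Green function of the cube -/

section Flow

variable {n N : ℕ}

/-- The neighbour of `x` in direction `i`. -/
def flipCoord (i : Fin n) (x : BoolCube n) : BoolCube n :=
  Hamming.toHamming fun j => if j = i then -Hamming.ofHamming x j else Hamming.ofHamming x j

lemma ofHamming_flipCoord (i j : Fin n) (x : BoolCube n) :
    Hamming.ofHamming (flipCoord i x) j =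
      if j = i then -Hamming.ofHamming x j else Hamming.ofHamming x j := rfl

lemma flipCoord_flipCoord (i : Fin n) (x : BoolCube n) : flipCoord i (flipCoord i x) = x := by
  refine Hamming.ofHamming.injective (funext fun j => ?_)
  simp only [ofHamming_flipCoord]
  split_ifs
  · exact neg_neg _
  · rfl

/-- `flipCoord` as a permutation. -/
def flipPerm (i : Fin n) : Equiv.Perm (BoolCube n) := 
  ⟨flipCoord i, flipCoord i, flipCoord_flipCoord i, flipCoord_flipCoord i⟩

lemma sum_comp_flipCoord (i : Fin n) (F : BoolCube n → ℝ) : ∑ x, F (flipCoord i x) = ∑ x, F x :=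
  Equiv.sum_comp (flipPerm i) F

lemma eq_flipCoord_iff (i : Fin n) (x y : BoolCube n) : y = flipCoord i x ↔ x = flipCoord i y :=
  ⟨fun h => by rw [h, flipCoord_flipCoord], fun h => by rw [h, flipCoord_flipCoord]⟩

lemma dist_flipCoord (i : Fin n) (x : BoolCube n) : dist x (flipCoord i x) = 1 := by
  have h : ∀ a : ℤˣ, a ≠ -a := by decide
  have : (Finset.univ.filter fun j => Hamming.ofHamming x j ≠ Hamming.ofHamming (flipCoord i x) j) =
      {i} := by
    ext j
    simp only [Finset.mem_filter, Finset.mem_univ, true_and, Finset.mem_singleton]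
    rw [ofHamming_flipCoord]
    split_ifs with hj
    · exact iff_of_true (h _) hj
    · exact iff_of_false (fun h' => h' rfl) hj
  rw [Hamming.dist_eq_hammingDist, hammingDist, this]
  simp

/-- An antisymmetric flow along the edges of the cube with divergence `m₁ - m₂` bounds the
Wasserstein distance. -/
lemma toReal_wassersteinDist_le_of_flow (m₁ m₂ : Measure (BoolCube n)) [IsFiniteMeasure m₁]
    [IsFiniteMeasure m₂] (Φ : Fin n → BoolCube n → ℝ)
    (hanti : ∀ i x, Φ i (flipCoord i x) = -Φ i x)
    (hdiv : ∀ x, ∑ i, Φ i x = m₁.real {x} - m₂.real {x}) :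
    (wassersteinDist m₁ m₂).toReal ≤ (∑ i, ∑ x, |Φ i x|) / 2 := by
  -- Only the positive part of `Φ` is shipped; antisymmetry supplies the reverse direction. The
  -- final factor `1 / 2` appears because each edge is seen from both ends.
  let γ : BoolCube n → BoolCube n → ℝ :=
    fun u v => ∑ i, if v = flipCoord i u then (|Φ i u| + Φ i u) / 2 else 0
  have hγ : ∀ u v, 0 ≤ γ u v := fun u v => Finset.sum_nonneg fun i _ => by
    split_ifs
    · linarith [neg_abs_le (Φ i u)]
    · exact le_rfl
  have hout : ∀ u, ∑ v, γ u v = ∑ i, (|Φ i u| + Φ i u) / 2 := fun u => by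
    rw [Finset.sum_comm]
    simp
  have hin : ∀ u, ∑ v, γ v u = ∑ i, (|Φ i u| - Φ i u) / 2 := fun u => by
    rw [Finset.sum_comm]
    simp only [eq_flipCoord_iff _ _ u, Finset.sum_ite_eq', Finset.mem_univ, if_true, hanti, abs_neg]
    rfl
  have hle := wassersteinDist_le_of_transshipment m₁ m₂ γ hγ fun u => by
    rw [hout, hin, ← Finset.sum_sub_distrib, ← hdiv]
    exact Finset.sum_congr rfl fun i _ => by ring
  have hcost : ∑ u, ∑ v, γ u v * dist u v = (∑ i, ∑ x, |Φ i x|) / 2 := by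
    have hzero : ∀ i, ∑ x, Φ i x = 0 := fun i => by
      have := sum_comp_flipCoord i (Φ i)
      simp only [hanti, Finset.sum_neg_distrib] at this
      linarith
    calc ∑ u, ∑ v, γ u v * dist u v = ∑ u, ∑ i, (|Φ i u| + Φ i u) / 2 := by
          refine Finset.sum_congr rfl fun u _ => ?_
          simp only [γ, Finset.sum_mul]
          rw [Finset.sum_comm]
          simp only [ite_mul, zero_mul, Finset.sum_ite_eq', Finset.mem_univ,
            if_true, dist_flipCoord, mul_one]
      _ = _ := by
          rw [Finset.sum_comm, Finset.sum_div]
          refine Finset.sum_congr rfl fun i _ => ?_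
          rw [← Finset.sum_div, Finset.sum_add_distrib, hzero, add_zero]
  rw [hcost] at hle
  exact ENNReal.toReal_le_of_le_ofReal (by positivity) hle

/-- The sign of the product of the `j`-th coordinates of `x` and `y`. -/
def coordSign (x y : BoolCube n) (j : Fin n) : ℝ :=
  if Hamming.ofHamming x j = Hamming.ofHamming y j then 1 else -1

lemma coordSign_comm (x y : BoolCube n) (j : Fin n) : coordSign x y j = coordSign y x j := by
  simp only [coordSign, eq_comm]

lemma coordSign_mul_self (x y : BoolCube n) (j : Fin n) :
    coordSign x y j * coordSign x y j = 1 := by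
  unfold coordSign; split_ifs <;> norm_num

lemma coordSign_flipCoord_self (x y : BoolCube n) (i : Fin n) :
    coordSign x (flipCoord i y) i = -coordSign x y i := by
  have h : ∀ a b : ℤˣ, a = -b ↔ ¬ a = b := by decide
  have h1 : Hamming.ofHamming (flipCoord i y) i = -Hamming.ofHamming y i := by
    simp [ofHamming_flipCoord]
  unfold coordSign
  rw [h1]
  by_cases h2 : Hamming.ofHamming x i = Hamming.ofHamming y i
  · rw [if_pos h2, if_neg (by rw [h]; exact not_not.2 h2)]
  · rw [if_neg h2, if_pos ((h _ _).2 h2), neg_neg]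

lemma coordSign_flipCoord_of_ne (x y : BoolCube n) {i j : Fin n} (h : j ≠ i) :
    coordSign x (flipCoord i y) j = coordSign x y j := by
  have h1 : Hamming.ofHamming (flipCoord i y) j = Hamming.ofHamming y j := by
    simp [ofHamming_flipCoord, h]
  rw [coordSign, h1, coordSign]

/-- The product `χ_S(x) χ_S(y)` of Walsh characters. -/
def walsh (S : Finset (Fin n)) (x y : BoolCube n) : ℝ := ∏ j ∈ S, coordSign x y j

lemma walsh_comm (S : Finset (Fin n)) (x y : BoolCube n) : walsh S x y = walsh S y x :=
  Finset.prod_congr rfl fun j _ => coordSign_comm x y j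

lemma walsh_mul_self (S : Finset (Fin n)) (x y : BoolCube n) : walsh S x y * walsh S x y = 1 := by
  rw [walsh, ← Finset.prod_mul_distrib]
  exact Finset.prod_eq_one fun j _ => coordSign_mul_self x y j

lemma walsh_flipCoord_of_mem {S : Finset (Fin n)} {i : Fin n} (hi : i ∈ S) (x y : BoolCube n) :
    walsh S x (flipCoord i y) = -walsh S x y := by
  rw [walsh, walsh, ← Finset.mul_prod_erase S _ hi, ← Finset.mul_prod_erase S _ hi,
    coordSign_flipCoord_self, neg_mul]
  congr 2
  exact Finset.prod_congr rfl fun j hj => coordSign_flipCoord_of_ne x y (Finset.ne_of_mem_erase hj)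

lemma walsh_flipCoord_of_notMem {S : Finset (Fin n)} {i : Fin n} (hi : i ∉ S) (x y : BoolCube n) :
    walsh S x (flipCoord i y) = walsh S x y :=
  Finset.prod_congr rfl fun _ hj => coordSign_flipCoord_of_ne x y fun h => hi (h ▸ hj)

/-- For `S ≠ T`, flipping a coordinate in exactly one of the two sets changes the sign of the
product, so the sum vanishes. -/
lemma sum_walsh_mul_walsh (S T : Finset (Fin n)) (x : BoolCube n) :
    ∑ y, walsh S x y * walsh T x y = if S = T then 2 ^ n else 0 := by
  split_ifs with h
  · subst h
    simp [walsh_mul_self, card_boolCube]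
  · obtain ⟨i, hi⟩ : ∃ i, ¬ (i ∈ S ↔ i ∈ T) := by
      by_contra! h'
      exact h (Finset.ext h')
    have hneg : ∀ y, walsh S x (flipCoord i y) * walsh T x (flipCoord i y) =
        -(walsh S x y * walsh T x y) := fun y => by
      by_cases hS : i ∈ S
      · have hT : i ∉ T := fun hT => hi (iff_of_true hS hT)
        rw [walsh_flipCoord_of_mem hS, walsh_flipCoord_of_notMem hT, neg_mul]
      · have hT : i ∈ T := by_contra fun hT => hi (iff_of_false hS hT)
        rw [walsh_flipCoord_of_notMem hS, walsh_flipCoord_of_mem hT, mul_neg]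
    have := sum_comp_flipCoord i fun y => walsh S x y * walsh T x y
    simp only [hneg, Finset.sum_neg_distrib] at this
    linarith

/-- The sum expands `∏ (1 + coordSign x y j)`, which has a zero factor as soon as one coordinate
differs. -/
lemma sum_walsh (x y : BoolCube n) : ∑ S, walsh S x y = if x = y then 2 ^ n else 0 := by
  have h := Finset.prod_one_add (f := coordSign x y) Finset.univ
  rw [Finset.powerset_univ] at h
  refine h.symm.trans ?_
  split_ifs with hxy
  · subst hxy
    simp only [coordSign, if_true]
    norm_num
  · obtain ⟨i, hi⟩ : ∃ i, Hamming.ofHamming x i ≠ Hamming.ofHamming y i :=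
      Function.ne_iff.1 hxy
    exact Finset.prod_eq_zero (Finset.mem_univ i) (by rw [coordSign, if_neg hi]; norm_num)

/-- The gradient in direction `i` of the Green function of the cube, multiplied by `2 ^ n`. -/
noncomputable def greenGradient (i : Fin n) (x y : BoolCube n) : ℝ :=
  ∑ S with i ∈ S, (S.card : ℝ)⁻¹ * walsh S x y

lemma greenGradient_flipCoord_right (i : Fin n) (x y : BoolCube n) :
    greenGradient i x (flipCoord i y) = -greenGradient i x y := by
  rw [greenGradient, greenGradient, ← Finset.sum_neg_distrib]
  refine Finset.sum_congr rfl fun S hS => ?_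
  rw [walsh_flipCoord_of_mem (Finset.mem_filter.1 hS).2, mul_neg]

lemma greenGradient_comm (i : Fin n) (x y : BoolCube n) :
    greenGradient i x y = greenGradient i y x :=
  Finset.sum_congr rfl fun S _ => by rw [walsh_comm]

lemma sum_greenGradient (i : Fin n) (x : BoolCube n) : ∑ y, greenGradient i x y = 0 := by
  have := sum_comp_flipCoord i (greenGradient i x)
  simp only [greenGradient_flipCoord_right, Finset.sum_neg_distrib] at this
  linarith

lemma sum_greenGradient_sq (i : Fin n) (x : BoolCube n) :
    ∑ y, greenGradient i x y ^ 2 =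
      2 ^ n * ∑ S : Finset (Fin n) with i ∈ S, ((S.card : ℝ)⁻¹) ^ 2 := by
  calc ∑ y, greenGradient i x y ^ 2
      = ∑ y, ∑ S : Finset (Fin n) with i ∈ S, ∑ T : Finset (Fin n) with i ∈ T,
          (S.card : ℝ)⁻¹ * (T.card : ℝ)⁻¹ * (walsh S x y * walsh T x y) := by
        refine Finset.sum_congr rfl fun y _ => ?_
        rw [pow_two, greenGradient, Finset.sum_mul_sum]
        exact Finset.sum_congr rfl fun S _ => Finset.sum_congr rfl fun T _ => by ring
    _ = ∑ S : Finset (Fin n) with i ∈ S, ∑ T : Finset (Fin n) with i ∈ T,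
          (S.card : ℝ)⁻¹ * (T.card : ℝ)⁻¹ * (if S = T then 2 ^ n else 0) := by
        rw [Finset.sum_comm]
        refine Finset.sum_congr rfl fun S _ => ?_
        rw [Finset.sum_comm]
        refine Finset.sum_congr rfl fun T _ => ?_
        rw [← Finset.mul_sum, sum_walsh_mul_walsh]
    _ = _ := by
        rw [Finset.mul_sum]
        refine Finset.sum_congr rfl fun S hS => ?_
        simp only [mul_ite, mul_zero, Finset.sum_ite_eq, hS, if_true]
        ring

/-- Each nonempty `S` is counted by `S.card` directions with weight `1 / S.card`, so every Walsh
function except the constant one appears exactly once. Up to the factor `2 ^ n`, the divergence is a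
point mass minus the uniform measure. -/
lemma sum_directions_greenGradient (x y : BoolCube n) :
    ∑ i, greenGradient i x y = (if x = y then 2 ^ n else 0) - 1 := by
  rw [← sum_walsh, ← Finset.sum_erase_add _ _ (Finset.mem_univ (∅ : Finset (Fin n)))]
  simp only [greenGradient, Finset.sum_filter]
  rw [Finset.sum_comm, ← Finset.sum_erase_add _ _ (Finset.mem_univ (∅ : Finset (Fin n)))]
  simp only [walsh, Finset.prod_empty, Finset.notMem_empty, if_false, Finset.sum_const_zero,
    add_zero, add_sub_cancel_right]
  refine Finset.sum_congr rfl fun S hS => ?_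
  have hS' : (S.card : ℝ) ≠ 0 := by
    simpa using Finset.ne_of_mem_erase hS
  rw [← Finset.sum_filter, Finset.sum_const, nsmul_eq_mul, Finset.filter_mem_eq_inter,
    Finset.univ_inter, ← mul_assoc, mul_inv_cancel₀ hS', one_mul]

/-- A set `S` occurs once for each of its elements, which turns `1 / S.card ^ 2` into `1 / S.card`;
the empty set contributes `0` because `0⁻¹ = 0`. -/
lemma sum_sum_inv_card_sq (n : ℕ) :
    ∑ i : Fin n, ∑ S : Finset (Fin n) with i ∈ S, ((S.card : ℝ)⁻¹) ^ 2 =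
      ∑ k ∈ Finset.range (n + 1), n.choose k * (k : ℝ)⁻¹ := by
  have h := Finset.sum_powerset_apply_card (fun k => (k : ℝ)⁻¹) (x := (Finset.univ : Finset (Fin n)))
  simp only [Finset.powerset_univ, Finset.card_univ, Fintype.card_fin, nsmul_eq_mul] at h
  rw [← h]
  simp only [Finset.sum_filter]
  rw [Finset.sum_comm]
  refine Finset.sum_congr rfl fun S _ => ?_
  rw [← Finset.sum_filter, Finset.sum_const, nsmul_eq_mul, Finset.filter_mem_eq_inter,
    Finset.univ_inter]
  rcases eq_or_ne (S.card : ℝ) 0 with h0 | h0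
  · simp [h0]
  · field_simp

/-- The flows of the sample points are averaged, so the flow on an edge in direction `i` is a mean
of `N` independent centred terms with second moment `A i`. Cauchy–Schwarz over directions loses
nothing, since by symmetry all `A i` are equal. -/
lemma meanCubeDist_le_green [NeZero N] :
    meanCubeDist n N ≤
      √(n * (∑ k ∈ Finset.range (n + 1), n.choose k * (k : ℝ)⁻¹) / N) / 2 := by
  have h2 : (0 : ℝ) < 2 ^ n := by positivity
  let A : Fin n → ℝ := fun i => ∑ S : Finset (Fin n) with i ∈ S, ((S.card : ℝ)⁻¹) ^ 2
  have hA : ∀ i, 0 ≤ A i := fun i => Finset.sum_nonneg fun S _ => by positivity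
  have hpoint : ∀ x : Fin N → BoolCube n,
      (wassersteinDist (empiricalMeasure x) (cubeUniform n)).toReal ≤
        (∑ i, ∑ u, |((2 : ℝ) ^ n)⁻¹ * ((∑ j, greenGradient i u (x j)) / N)|) / 2 := by
    intro x
    refine toReal_wassersteinDist_le_of_flow _ _
      (fun i u => ((2 : ℝ) ^ n)⁻¹ * ((∑ j, greenGradient i u (x j)) / N)) (fun i u => ?_)
      fun u => ?_
    · simp only [greenGradient_comm _ _ (x _), greenGradient_flipCoord_right, Finset.sum_neg_distrib]
      ring
    · have hN : (N : ℝ) ≠ 0 := by exact_mod_cast NeZero.ne N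
      rw [← Finset.mul_sum, ← Finset.sum_div, Finset.sum_comm]
      simp only [sum_directions_greenGradient]
      rw [empiricalMeasure_real_singleton, cubeUniform_real_singleton, Finset.sum_sub_distrib]
      have : ∀ j, (if u = x j then (2 : ℝ) ^ n else 0) = 2 ^ n * if x j = u then 1 else 0 := by
        intro j
        simp [eq_comm]
      simp only [this, ← Finset.mul_sum]
      simp only [Finset.sum_const, Finset.card_univ, Fintype.card_fin, nsmul_eq_mul, mul_one]
      field_simp
  have hint : ∀ i u, ∫ x : Fin N → BoolCube n,
      |(∑ j, greenGradient i u (x j)) / N| ∂(sampleLaw n N) ≤ √(A i / N) := by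
    intro i u
    have := integral_abs_average_sub_le (N := N) (greenGradient i u)
    rw [sum_greenGradient, sum_greenGradient_sq, mul_div_cancel_left₀ _ h2.ne'] at this
    simpa only [zero_div, sub_zero] using this
  calc meanCubeDist n N
      ≤ ∫ x, (∑ i, ∑ u, |((2 : ℝ) ^ n)⁻¹ * ((∑ j, greenGradient i u (x j)) / N)|) / 2
          ∂(sampleLaw n N) := integral_mono .of_finite .of_finite hpoint
    _ = (∑ i, ∑ u, ((2 : ℝ) ^ n)⁻¹ * ∫ x : Fin N → BoolCube n,
          |(∑ j, greenGradient i u (x j)) / N| ∂(sampleLaw n N)) / 2 := by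
        rw [integral_div, integral_finsetSum _ fun _ _ => .of_finite]
        congr 1
        refine Finset.sum_congr rfl fun i _ => ?_
        rw [integral_finsetSum _ fun _ _ => .of_finite]
        refine Finset.sum_congr rfl fun u _ => ?_
        rw [← integral_const_mul]
        simp only [abs_mul, abs_of_nonneg (inv_nonneg.2 h2.le)]
    _ ≤ (∑ i, ∑ _u : BoolCube n, ((2 : ℝ) ^ n)⁻¹ * √(A i / N)) / 2 := by
        gcongr with i _ u _
        exact hint i u
    _ = (∑ i, √(A i / N)) / 2 := by
        simp only [Finset.sum_const, Finset.card_univ, card_boolCube, nsmul_eq_mul]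
        congr 1
        refine Finset.sum_congr rfl fun i _ => ?_
        push_cast
        field_simp
    _ ≤ √(n * (∑ k ∈ Finset.range (n + 1), n.choose k * (k : ℝ)⁻¹) / N) / 2 := by
        gcongr
        refine Real.le_sqrt_of_sq_le ?_
        refine (sq_sum_le_card_mul_sum_sq).trans (le_of_eq ?_)
        simp only [fun i => Real.sq_sqrt (div_nonneg (hA i) N.cast_nonneg)]
        rw [← Finset.sum_div, sum_sum_inv_card_sq, Finset.card_univ, Fintype.card_fin, mul_div_assoc]

/-- For `k ≥ 1` one has `1 / k ≤ 1 / (k + 1) + 3 / ((k + 1) * (k + 2))`, with equality at `k = 1`.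
These denominators are absorbed into binomial coefficients of orders `n + 1` and `n + 2`, which sum
to powers of two. -/
lemma sum_choose_mul_inv_le (n : ℕ) :
    ∑ k ∈ Finset.range (n + 1), n.choose k * (k : ℝ)⁻¹ ≤
      2 ^ (n + 1) / (n + 1) * (1 + 6 / (n + 2)) := by
  have hk : ∀ k : ℕ, (n.choose k : ℝ) * (k : ℝ)⁻¹ ≤
      (n + 1).choose (k + 1) / (n + 1) + 3 * ((n + 2).choose (k + 2) / ((n + 1) * (n + 2))) := by
    intro k
    have e1 : ((n + 1).choose (k + 1) : ℝ) = (n + 1) * n.choose k / (k + 1) := by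
      rw [eq_div_iff (by positivity)]
      exact_mod_cast (Nat.add_one_mul_choose_eq n k).symm
    have e2 : ((n + 2).choose (k + 2) : ℝ) = (n + 2) * (n + 1).choose (k + 1) / (k + 2) := by
      rw [eq_div_iff (by positivity)]
      exact_mod_cast (Nat.add_one_mul_choose_eq (n + 1) (k + 1)).symm
    rw [e2, e1]
    have e3 : ((n + 1) * n.choose k / (k + 1) / (n + 1) + 3 * ((n + 2) * ((n + 1) * n.choose k /
        (k + 1)) / (k + 2) / ((n + 1) * (n + 2))) : ℝ) =
        n.choose k * (1 / (k + 1) + 3 / ((k + 1) * (k + 2))) := by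
      field_simp
    rw [e3]
    gcongr
    rcases Nat.eq_zero_or_pos k with rfl | hpos
    · norm_num
    · have : (1 : ℝ) ≤ k := by exact_mod_cast hpos
      rw [div_add_div _ _ (by positivity) (by positivity), inv_eq_one_div,
        div_le_div_iff₀ (by positivity) (by positivity)]
      nlinarith [sq_nonneg ((k : ℝ) - 1)]
  have hshift : ∀ m j : ℕ, ∑ k ∈ Finset.range (n + 1), ((m.choose (k + j) : ℕ) : ℝ) ≤
      ∑ k ∈ Finset.range (n + 1 + j), (m.choose k : ℝ) := by
    intro m j
    rw [Finset.range_eq_Ico, Finset.sum_Ico_add' (fun k => (m.choose k : ℝ)), zero_add]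
    exact Finset.sum_le_sum_of_subset_of_nonneg
      (fun k hk => Finset.mem_range.2 (Finset.mem_Ico.1 hk).2) fun _ _ _ => by positivity
  have s1 : ∑ k ∈ Finset.range (n + 1), ((n + 1).choose (k + 1) : ℝ) ≤ 2 ^ (n + 1) :=
    (hshift (n + 1) 1).trans (le_of_eq (by exact_mod_cast Nat.sum_range_choose (n + 1)))
  have s2 : ∑ k ∈ Finset.range (n + 1), ((n + 2).choose (k + 2) : ℝ) ≤ 2 ^ (n + 2) :=
    (hshift (n + 2) 2).trans (le_of_eq (by exact_mod_cast Nat.sum_range_choose (n + 2)))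
  calc ∑ k ∈ Finset.range (n + 1), n.choose k * (k : ℝ)⁻¹
      ≤ ∑ k ∈ Finset.range (n + 1), ((n + 1).choose (k + 1) / (n + 1) +
          3 * ((n + 2).choose (k + 2) / ((n + 1) * (n + 2))) : ℝ) :=
        Finset.sum_le_sum fun k _ => hk k
    _ = (∑ k ∈ Finset.range (n + 1), ((n + 1).choose (k + 1) : ℝ)) / (n + 1) +
          3 * ((∑ k ∈ Finset.range (n + 1), ((n + 2).choose (k + 2) : ℝ)) /
            ((n + 1) * (n + 2))) := by
        rw [Finset.sum_add_distrib, Finset.sum_div, ← Finset.mul_sum, Finset.sum_div]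
    _ ≤ 2 ^ (n + 1) / (n + 1) + 3 * (2 ^ (n + 2) / ((n + 1) * (n + 2))) := by gcongr
    _ = _ := by
        field_simp
        ring

lemma meanCubeDist_le_sqrt [NeZero N] :
    meanCubeDist n N ≤ √(2 ^ n / (2 * N) * (n / (n + 1) * (1 + 6 / (n + 2)))) := by
  refine meanCubeDist_le_green.trans ?_
  have h4 : (2 : ℝ) = √4 := by
    rw [show (4 : ℝ) = 2 ^ 2 by norm_num, Real.sqrt_sq (by norm_num)]
  nth_rewrite 1 [h4]
  rw [← Real.sqrt_div' _ (by norm_num)]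
  refine Real.sqrt_le_sqrt ?_
  have hN : (0 : ℝ) < N := by exact_mod_cast NeZero.pos N
  calc n * (∑ k ∈ Finset.range (n + 1), n.choose k * (k : ℝ)⁻¹) / N / 4
      ≤ n * (2 ^ (n + 1) / (n + 1) * (1 + 6 / (n + 2))) / N / 4 := by
        gcongr
        exact sum_choose_mul_inv_le n
    _ = _ := by
        field_simp
        ring

end Flow

/-! ### Asymptotics -/

section Asymptotics

lemma LimitsBetween.of_tendsto {a b : ℝ} {u l v : ℕ → ℝ} (hl : Tendsto l atTop (𝓝 a))
    (hv : Tendsto v atTop (𝓝 b)) (hlu : ∀ᶠ n in atTop, l n ≤ u n)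
    (huv : ∀ᶠ n in atTop, u n ≤ v n) : LimitsBetween a u b := by
  refine ⟨?_, liminf_le_limsup, ?_⟩
  · rw [← (EReal.tendsto_coe.2 hl).liminf_eq]
    exact liminf_le_liminf (hlu.mono fun n h => EReal.coe_le_coe h)
  · rw [← (EReal.tendsto_coe.2 hv).limsup_eq]
    exact limsup_le_limsup (huv.mono fun n h => EReal.coe_le_coe h)

lemma tendsto_div_of_abs_sub_lt_one {ι : Type*} {f : Filter ι} {x y : ι → ℝ}
    (hy : Tendsto y f atTop) (h : ∀ᶠ i in f, |x i - y i| < 1) :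
    Tendsto (fun i => x i / y i) f (𝓝 1) := by
  have h0 : Tendsto (fun i => (x i - y i) / y i) f (𝓝 0) := by
    refine squeeze_zero_norm' ?_ (tendsto_inv_atTop_zero.comp hy)
    filter_upwards [h, hy.eventually_gt_atTop 0] with i hi hpos
    rw [Real.norm_eq_abs, abs_div, abs_of_pos hpos, Function.comp_apply, inv_eq_one_div]
    gcongr
  have h1 := h0.add_const 1
  rw [zero_add] at h1
  refine h1.congr' ?_
  filter_upwards [hy.eventually_gt_atTop 0] with i hpos
  field_simp
  ring

lemma tendsto_one_add_six_div :
    Tendsto (fun n : ℕ => ((n : ℝ) / (n + 1) * (1 + 6 / (n + 2)))) atTop (𝓝 1) := by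
  have h1 : Tendsto (fun n : ℕ => (n : ℝ) / (n + 1)) atTop (𝓝 1) := by
    simpa using tendsto_natCast_div_add_atTop (1 : ℝ)
  have h2 : Tendsto (fun n : ℕ => (6 : ℝ) / (n + 2)) atTop (𝓝 0) :=
    tendsto_const_nhds.div_atTop
      (tendsto_atTop_add_const_right _ _ tendsto_natCast_atTop_atTop)
  simpa using h1.mul (h2.const_add 1)

lemma eventually_neZero_of_div_tendsto {N : ℕ → ℕ} {y : ℕ → ℝ} {a : ℝ} (ha : a ≠ 0)
    (h : Tendsto (fun n => (N n : ℝ) / y n) atTop (𝓝 a)) : ∀ᶠ n in atTop, NeZero (N n) := by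
  filter_upwards [h.eventually_ne ha] with n hn
  refine ⟨fun h0 => hn ?_⟩
  simp [h0]

lemma limitsBetween_of_constant_density (N : ℕ → ℕ) (c : ℝ) (hc : 0 < c)
    (hN : ∀ᶠ n in atTop, |(N n : ℝ) - c * 2 ^ n| < 1) :
    LimitsBetween (Real.exp (-c)) (fun n => meanCubeDist n (N n)) (1 / √(2 * c)) := by
  have h2 : Tendsto (fun n : ℕ => (2 : ℝ) ^ n) atTop atTop :=
    tendsto_pow_atTop_atTop_of_one_lt one_lt_two
  have hratio : Tendsto (fun n => (N n : ℝ) / 2 ^ n) atTop (𝓝 c) := by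
    have h := (tendsto_div_of_abs_sub_lt_one (h2.const_mul_atTop hc) hN).const_mul c
    rw [mul_one] at h
    refine h.congr fun n => ?_
    field_simp
  have hNe := eventually_neZero_of_div_tendsto hc.ne' hratio
  have hq : Tendsto (fun n : ℕ => ((2 : ℝ) ^ n)⁻¹) atTop (𝓝 0) := tendsto_inv_atTop_zero.comp h2
  refine LimitsBetween.of_tendsto
    (l := fun n => Real.exp (-((N n : ℝ) / 2 ^ n / (1 - ((2 : ℝ) ^ n)⁻¹))))
    (v := fun n => √((2 * ((N n : ℝ) / 2 ^ n))⁻¹ * (n / (n + 1) * (1 + 6 / (n + 2))))) ?_ ?_ ?_ ?_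
  · refine (Real.continuous_exp.tendsto _).comp (Tendsto.neg ?_)
    have h := hratio.div (hq.const_sub 1) (by norm_num)
    rwa [sub_zero, div_one] at h
  · have h := ((hratio.const_mul 2).inv₀ (by positivity)).mul tendsto_one_add_six_div
    have h' := (Real.continuous_sqrt.tendsto _).comp h
    rwa [mul_one, Real.sqrt_inv, ← one_div] at h'
  · filter_upwards [hNe, eventually_ge_atTop 1] with n hn hn1
    -- For `ν = 1` the bound is `(1 - 2⁻ⁿ) ^ N`, the probability that a given point is missed.
    refine le_trans ?_ (le_meanCubeDist_of_deviation (n := n) 1 (NeZero.pos (N n)))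
    have hNpos : (0 : ℝ) < N n := by exact_mod_cast NeZero.pos (N n)
    have hq1 : ((2 : ℝ) ^ n)⁻¹ < 1 := inv_lt_one_of_one_lt₀ (one_lt_pow₀ one_lt_two (by omega))
    have e : (2 : ℝ) ^ n / N n * ((1 : ℕ) * (N n).choose 1 * ((2 : ℝ) ^ n)⁻¹ ^ 1 *
        (1 - ((2 : ℝ) ^ n)⁻¹) ^ (N n + 1 - 1)) = (1 - ((2 : ℝ) ^ n)⁻¹) ^ N n := by
      rw [Nat.choose_one_right, Nat.add_sub_cancel]
      field_simp
      simp
    rw [e, ← Real.log_le_log_iff (Real.exp_pos _) (pow_pos (by linarith) _), Real.log_exp,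
      Real.log_pow]
    have h1 := Real.one_sub_inv_le_log_of_pos (x := 1 - ((2 : ℝ) ^ n)⁻¹) (by linarith)
    calc -((N n : ℝ) / 2 ^ n / (1 - ((2 : ℝ) ^ n)⁻¹))
        = N n * (1 - (1 - ((2 : ℝ) ^ n)⁻¹)⁻¹) := by
          have : 1 - ((2 : ℝ) ^ n)⁻¹ ≠ 0 := by linarith
          rw [div_eq_mul_inv (N n : ℝ)]
          generalize ((2 : ℝ) ^ n)⁻¹ = q at this
          field_simp
          ring
      _ ≤ _ := by gcongr
  · filter_upwards [hNe] with n hn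
    refine (meanCubeDist_le_sqrt (n := n) (N := N n)).trans (le_of_eq ?_)
    congr 2
    field_simp

/-! ### Entropy estimates for binomial coefficients. -/

/-- Each binomial coefficient carries at least the mean weight of its own binomial law. -/
lemma pow_le_mul_choose_mul (n k : ℕ) (hk : k ≤ n) :
    (n : ℝ) ^ n ≤ (n + 1) * (n.choose k * (k : ℝ) ^ k * ((n - k : ℕ) : ℝ) ^ (n - k)) := by
  -- The `t j` are the `n + 1` terms of the expansion of `(k + (n - k)) ^ n`. The ratio of
  -- consecutive terms shows that the largest is `t k`.
  let t : ℕ → ℝ := fun j => (k : ℝ) ^ j * ((n - k : ℕ) : ℝ) ^ (n - j) * n.choose j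
  have hstep : ∀ j < n, t (j + 1) * ((j + 1) * (n - k : ℕ)) = t j * ((n - j) * k) := by
    intro j hj
    obtain ⟨d, rfl⟩ : ∃ d, n = j + 1 + d := ⟨n - (j + 1), by omega⟩
    have hc : (((j + 1 + d).choose (j + 1) : ℕ) : ℝ) * (j + 1) =
        ((j + 1 + d).choose j : ℕ) * (d + 1) := by
      have := Nat.choose_succ_right_eq (j + 1 + d) j
      rw [show j + 1 + d - j = d + 1 by omega] at this
      exact_mod_cast this
    simp only [t]
    rw [show j + 1 + d - (j + 1) = d by omega, show j + 1 + d - j = d + 1 by omega]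
    push_cast
    linear_combination ((k : ℝ) ^ (j + 1) * ((j + 1 + d - k : ℕ) : ℝ) ^ (d + 1)) * hc
  have ht0 : ∀ j, 0 ≤ t j := fun j => by positivity
  have hkn : ((n - k : ℕ) : ℝ) = n - k := Nat.cast_sub hk
  have hmono : ∀ j < k, t j ≤ t (j + 1) := by
    intro j hj
    rcases hk.eq_or_lt with rfl | hlt
    · have : t j = 0 := by
        simp only [t, Nat.sub_self, Nat.cast_zero]
        rw [zero_pow (by omega)]; ring
      rw [this]; exact ht0 _
    · have h1 := hstep j (by omega)
      have hj' : (j : ℝ) + 1 ≤ k := by exact_mod_cast hj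
      have hlt' : (k : ℝ) + 1 ≤ n := by exact_mod_cast hlt
      rw [hkn] at h1
      have hpos : (0 : ℝ) < (j + 1) * (n - k) := by
        apply mul_pos <;> [positivity; linarith]
      have hle : ((j : ℝ) + 1) * (n - k) ≤ (n - j) * k := by nlinarith
      refine le_of_mul_le_mul_right ?_ hpos
      rw [h1]
      exact mul_le_mul_of_nonneg_left hle (ht0 j)
  have hanti : ∀ j, k ≤ j → j < n → t (j + 1) ≤ t j := by
    intro j hkj hj
    have h1 := hstep j hj
    have hj' : (k : ℝ) ≤ j := by exact_mod_cast hkj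
    have hlt' : (j : ℝ) + 1 ≤ n := by exact_mod_cast hj
    rw [hkn] at h1
    have hpos : (0 : ℝ) < (j + 1) * (n - k) := by
      apply mul_pos <;> [positivity; linarith]
    have hle : (n - j) * k ≤ ((j : ℝ) + 1) * (n - k) := by nlinarith
    refine le_of_mul_le_mul_right ?_ hpos
    rw [h1]
    exact mul_le_mul_of_nonneg_left hle (ht0 j)
  have hmax : ∀ j ≤ n, t j ≤ t k := by
    intro j hj
    rcases le_total j k with h | h
    · exact Nat.decreasingInduction' (P := fun i => t i ≤ t k)
        (fun i hi _ ih => (hmono i hi).trans ih) h le_rfl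
    · induction j, h using Nat.le_induction with
      | base => exact le_rfl
      | succ i hi ih => exact (hanti i hi (by omega)).trans (ih (by omega))
  calc (n : ℝ) ^ n = ((k : ℝ) + (n - k : ℕ)) ^ n := by rw [hkn]; ring
    _ = ∑ j ∈ Finset.range (n + 1), t j := add_pow _ _ _
    _ ≤ ∑ _j ∈ Finset.range (n + 1), t k :=
        Finset.sum_le_sum fun j hj => hmax j (Nat.lt_succ_iff.1 (Finset.mem_range.1 hj))
    _ = _ := by
        rw [Finset.sum_const, Finset.card_range, nsmul_eq_mul]
        push_cast
        ring

/-- The entropy lower bound for binomial coefficients. -/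
lemma exp_binEntropy_le_choose (n k : ℕ) (hk0 : 0 < k) (hkn : k < n) :
    Real.exp (n * Real.binEntropy (k / n)) ≤ (n + 1) * n.choose k := by
  have hk : (0 : ℝ) < k := by exact_mod_cast hk0
  have hn : (0 : ℝ) < n := by exact_mod_cast hk0.trans hkn
  have hnk : (0 : ℝ) < n - k := by
    have : (k : ℝ) < n := by exact_mod_cast hkn
    linarith
  have h := pow_le_mul_choose_mul n k hkn.le
  have hcast : ((n - k : ℕ) : ℝ) = n - k := Nat.cast_sub hkn.le
  rw [hcast] at h
  have hE : Real.exp (n * Real.binEntropy (k / n)) * ((k : ℝ) ^ k * (n - k : ℝ) ^ (n - k)) =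
      n ^ n := by
    have e1 : (1 : ℝ) - k / n = (n - k) / n := by field_simp
    rw [← Real.exp_log (pow_pos hk k), ← Real.exp_log (pow_pos hnk (n - k)),
      ← Real.exp_log (pow_pos hn n), ← Real.exp_add, ← Real.exp_add, Real.log_pow, Real.log_pow,
      Real.log_pow, Real.binEntropy_eq_negMulLog_add_negMulLog_one_sub, Real.negMulLog,
      Real.negMulLog, e1, Real.log_div hk.ne' hn.ne', Real.log_div hnk.ne' hn.ne', hcast]
    congr 1
    field_simp
    ring
  have hpos : 0 < (k : ℝ) ^ k * (n - k : ℝ) ^ (n - k) := by positivity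
  refine le_of_mul_le_mul_right ?_ hpos
  rw [hE]
  linarith

/-- The tangent line of the concave function `binEntropy` at `p`, evaluated at `r ≤ p`. -/
lemma binEntropy_add_le (r p : ℝ) (hr : 0 < r) (hrp : r ≤ p) (hp : p < 1) :
    Real.binEntropy r + (p - r) * Real.log ((1 - p) / p) ≤ Real.binEntropy p := by
  have hp0 : 0 < p := hr.trans_le hrp
  have hd := Real.hasDerivAt_binEntropy hp0.ne' hp.ne
  rcases hrp.eq_or_lt with rfl | hlt
  · simp
  · have h := (Real.strictConcave_binEntropy.concaveOn).le_slope_of_hasDerivAt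
      ⟨hr.le, by linarith⟩ ⟨hp0.le, hp.le⟩ hlt hd
    rw [slope_def_field, le_div_iff₀ (by linarith)] at h
    rw [Real.log_div (by linarith) hp0.ne']
    linarith

end Asymptotics

/-! ### Samples much larger than the cube: local Stirling asymptotics. -/

section LargeSamples

open Stirling in
/-- Stirling's formula for a term of the binomial law. -/
lemma choose_mul_pow_eq_stirling (ν M : ℕ) (hν : 0 < ν) (hM : 0 < M) (q : ℝ) :
    (ν + M).choose ν * q ^ ν * (1 - q) ^ M =
      stirlingSeq (ν + M) / (stirlingSeq ν * stirlingSeq M) *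
        √((ν + M : ℝ) / (2 * ν * M)) *
        (((ν + M : ℝ) * q / ν) ^ ν * ((ν + M : ℝ) * (1 - q) / M) ^ M) := by
  have hν' : (0 : ℝ) < ν := by exact_mod_cast hν
  have hM' : (0 : ℝ) < M := by exact_mod_cast hM
  have hch : ((ν + M).choose ν : ℝ) = (ν + M).factorial / (ν.factorial * M.factorial) :=
    Nat.cast_add_choose ℝ
  have hsq : √((ν + M : ℝ) / (2 * ν * M)) = √(2 * (ν + M : ℝ)) / (√(2 * ν) * √(2 * M)) := by
    rw [← Real.sqrt_mul (by positivity), ← Real.sqrt_div (by positivity)]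
    congr 1
    field_simp
  have h1 : √(2 * (ν : ℝ)) ≠ 0 := by positivity
  have h2 : √(2 * (M : ℝ)) ≠ 0 := by positivity
  have h3 : √(2 * (ν + M : ℝ)) ≠ 0 := by positivity
  have h4 : (ν.factorial : ℝ) ≠ 0 := by positivity
  have h5 : (M.factorial : ℝ) ≠ 0 := by positivity
  rw [hch, hsq]
  simp only [stirlingSeq]
  push_cast
  simp only [div_pow, mul_pow, pow_add]
  field_simp

/-- The relative entropy of nearby binomial parameters is small. -/
lemma exp_neg_le_pow_mul_pow (ν M : ℕ) (hν : 0 < ν) (hM : 0 < M) (m : ℝ) (hm : 0 < m)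
    (hm' : m < ν + M) :
    Real.exp (-((ν - m) ^ 2 * (1 / m + 1 / (ν + M - m)))) ≤
      (m / ν) ^ ν * ((ν + M - m) / M) ^ M := by
  have hν' : (0 : ℝ) < ν := by exact_mod_cast hν
  have hM' : (0 : ℝ) < M := by exact_mod_cast hM
  have hd : 0 < ν + M - m := by linarith
  -- Applying `log x ≥ 1 - 1 / x` to both factors leaves linear terms that cancel, since `ν` and `M`
  -- have the same sum as `m` and `ν + M - m`.
  have h1 := Real.one_sub_inv_le_log_of_pos (div_pos hm hν')
  have h2 := Real.one_sub_inv_le_log_of_pos (div_pos hd hM')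
  rw [← Real.exp_log (pow_pos (div_pos hm hν') ν), ← Real.exp_log (pow_pos (div_pos hd hM') M),
    ← Real.exp_add, Real.log_pow, Real.log_pow]
  refine Real.exp_le_exp.2 ?_
  calc -((ν - m) ^ 2 * (1 / m + 1 / (ν + M - m)))
      = ν * (1 - (m / ν)⁻¹) + M * (1 - ((ν + M - m) / M)⁻¹) := by
        field_simp
        ring
    _ ≤ _ := by gcongr

/-- With `m = N / 2 ^ n` and `ν = ⌈m⌉`, de Moivre's bound is asymptotic to the binomial probability
of the value `ν`, hence to `1 / √(2πm)`, and `m` is asymptotic to `c`. The upper bound is the Green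
function estimate. -/
lemma limitsBetween_of_density_atTop (N : ℕ → ℕ) (c : ℕ → ℝ) (hc : Tendsto c atTop atTop)
    (hN : ∀ᶠ n in atTop, |(N n : ℝ) - c n * 2 ^ n| < 1) :
    LimitsBetween (√(1 / (2 * Real.pi))) (fun n => √(c n) * meanCubeDist n (N n)) (√2 / 2) := by
  have h2 : Tendsto (fun n : ℕ => (2 : ℝ) ^ n) atTop atTop :=
    tendsto_pow_atTop_atTop_of_one_lt one_lt_two
  have hq : Tendsto (fun n : ℕ => ((2 : ℝ) ^ n)⁻¹) atTop (𝓝 0) := tendsto_inv_atTop_zero.comp h2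
  have hratio := tendsto_div_of_abs_sub_lt_one (hc.atTop_mul_atTop₀ h2) hN
  have hNe := eventually_neZero_of_div_tendsto one_ne_zero hratio
  have hcpos := hc.eventually_gt_atTop 0
  -- the mean number of sample points at a given point
  set m : ℕ → ℝ := fun n => N n * ((2 : ℝ) ^ n)⁻¹ with hm_def
  have hmc : Tendsto (fun n => m n / c n) atTop (𝓝 1) := by
    refine hratio.congr fun n => ?_
    simp only [hm_def]
    field_simp
  have hm : Tendsto m atTop atTop := by
    refine (hmc.pos_mul_atTop one_pos hc).congr' ?_
    filter_upwards [hcpos] with n hn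
    field_simp
  have hNtop : Tendsto (fun n => (N n : ℝ)) atTop atTop := by
    refine (hm.atTop_mul_atTop₀ h2).congr fun n => ?_
    simp only [hm_def]
    field_simp
  set ν : ℕ → ℕ := fun n => ⌈m n⌉₊ with hν_def
  have hν1 : ∀ᶠ n in atTop, |(ν n : ℝ) - m n| < 1 := by
    filter_upwards [hm.eventually_gt_atTop 0] with n hn
    rw [abs_of_nonneg (sub_nonneg.2 (Nat.le_ceil _))]
    linarith [Nat.ceil_lt_add_one hn.le]
  have hνm := tendsto_div_of_abs_sub_lt_one hm hν1
  have hνtop : Tendsto (fun n => (ν n : ℝ)) atTop atTop :=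
    tendsto_atTop_mono (fun n => Nat.le_ceil _) hm
  have hνN : Tendsto (fun n => (ν n : ℝ) / N n) atTop (𝓝 0) := by
    have h := hνm.mul hq
    rw [mul_zero] at h
    refine h.congr' ?_
    filter_upwards [hNe] with n hn
    have : (0 : ℝ) < N n := by exact_mod_cast NeZero.pos (N n)
    simp only [hm_def]
    field_simp
  have hMN : Tendsto (fun n => ((N n : ℝ) - ν n) / N n) atTop (𝓝 1) := by
    have h := hνN.const_sub 1
    rw [sub_zero] at h
    refine h.congr' ?_
    filter_upwards [hNe] with n hn
    have : (0 : ℝ) < N n := by exact_mod_cast NeZero.pos (N n)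
    field_simp
  have hMtop' : Tendsto (fun n => (N n : ℝ) - ν n) atTop atTop := by
    refine (hMN.pos_mul_atTop one_pos hNtop).congr' ?_
    filter_upwards [hNe] with n hn
    have : (0 : ℝ) < N n := by exact_mod_cast NeZero.pos (N n)
    field_simp
  have hMcast : ∀ᶠ n in atTop, ((N n - ν n : ℕ) : ℝ) = N n - ν n ∧ ν n < N n := by
    filter_upwards [hMtop'.eventually_gt_atTop 0] with n hn
    have : ν n < N n := by exact_mod_cast sub_pos.1 hn
    exact ⟨Nat.cast_sub this.le, this⟩
  have hMtop : Tendsto (fun n => N n - ν n) atTop atTop := by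
    refine tendsto_natCast_atTop_iff (R := ℝ) |>.1 (hMtop'.congr' ?_)
    filter_upwards [hMcast] with n hn
    exact hn.1.symm
  have hS : Tendsto (fun n => Stirling.stirlingSeq (N n) /
      (Stirling.stirlingSeq (ν n) * Stirling.stirlingSeq (N n - ν n))) atTop
      (𝓝 (√Real.pi / (√Real.pi * √Real.pi))) := by
    have hs := Stirling.tendsto_stirlingSeq_sqrt_pi
    exact (hs.comp (tendsto_natCast_atTop_iff.1 hNtop)).div
      ((hs.comp (tendsto_natCast_atTop_iff.1 hνtop)).mul (hs.comp hMtop))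
      (by have := Real.pi_pos; positivity)
  have hsqrt : Tendsto (fun n => √((m n / c n)⁻¹ * ((ν n / m n)⁻¹ *
      (((N n : ℝ) - ν n) / N n)⁻¹) / 2)) atTop (𝓝 √((1 : ℝ)⁻¹ * (1⁻¹ * 1⁻¹) / 2)) :=
    (Real.continuous_sqrt.tendsto _).comp
      (((hmc.inv₀ one_ne_zero).mul ((hνm.inv₀ one_ne_zero).mul
        (hMN.inv₀ one_ne_zero))).div_const 2)
  -- Rounding moves `m` by less than `1`, while `m` and `N - m` both tend to infinity, so the
  -- relative entropy error vanishes.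
  have hR : Tendsto (fun n => Real.exp (-(((ν n : ℝ) - m n) ^ 2 *
      (1 / m n + 1 / (N n - m n))))) atTop (𝓝 1) := by
    suffices h : Tendsto (fun n => ((ν n : ℝ) - m n) ^ 2 * (1 / m n + 1 / (N n - m n)))
        atTop (𝓝 0) by
      have h' := (Real.continuous_exp.tendsto _).comp h.neg
      rwa [neg_zero, Real.exp_zero] at h'
    have hinv : Tendsto (fun n => 1 / m n + 1 / ((N n : ℝ) - ν n)) atTop (𝓝 0) := by
      simpa using (tendsto_inv_atTop_zero.comp hm).add (tendsto_inv_atTop_zero.comp hMtop')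
    refine squeeze_zero' ?_ ?_ hinv
    · filter_upwards [hm.eventually_gt_atTop 0, hMtop'.eventually_gt_atTop 0] with n h1 h3
      have := Nat.le_ceil (m n)
      have : 0 < (N n : ℝ) - m n := by linarith
      positivity
    · filter_upwards [hm.eventually_gt_atTop 0, hMtop'.eventually_gt_atTop 0, hν1] with n h1 h3 h4
      have h5 := Nat.le_ceil (m n)
      have h6 : (ν n - m n) ^ 2 ≤ 1 := by
        rw [← sq_abs]
        exact pow_le_one₀ (abs_nonneg _) h4.le
      have h7 : 1 / ((N n : ℝ) - m n) ≤ 1 / (N n - ν n) :=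
        one_div_le_one_div_of_le h3 (by linarith)
      have h8 : 0 < 1 / m n := by positivity
      have h9 : 0 < 1 / ((N n : ℝ) - m n) := one_div_pos.2 (by linarith)
      nlinarith
  refine LimitsBetween.of_tendsto
    (l := fun n => (ν n / m n) * (1 - ((2 : ℝ) ^ n)⁻¹) *
      (Stirling.stirlingSeq (N n) /
        (Stirling.stirlingSeq (ν n) * Stirling.stirlingSeq (N n - ν n)) *
      √((m n / c n)⁻¹ * ((ν n / m n)⁻¹ * (((N n : ℝ) - ν n) / N n)⁻¹) / 2) *
      Real.exp (-(((ν n : ℝ) - m n) ^ 2 * (1 / m n + 1 / (N n - m n))))))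
    (v := fun n => √((2 * (m n / c n))⁻¹ * (n / (n + 1) * (1 + 6 / (n + 2))))) ?_ ?_ ?_ ?_
  · have h := (hνm.mul (hq.const_sub 1)).mul ((hS.mul hsqrt).mul hR)
    convert! h using 2
    have hpi : 0 < √Real.pi := Real.sqrt_pos.2 Real.pi_pos
    rw [one_div, Real.sqrt_inv, Real.sqrt_mul (by norm_num)]
    norm_num
  · have h := ((hmc.const_mul 2).inv₀ (by norm_num)).mul tendsto_one_add_six_div
    have h' := (Real.continuous_sqrt.tendsto _).comp h
    rw [mul_one, mul_one, Real.sqrt_inv, ← one_div] at h'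
    convert! h' using 2
    have : √2 * √2 = (2 : ℝ) := Real.mul_self_sqrt (by norm_num)
    field_simp
    linarith
  · filter_upwards [hNe, hcpos, hm.eventually_gt_atTop 0, hMcast, hMtop'.eventually_gt_atTop 0,
      eventually_ge_atTop 1] with n hn hcn hmn hMn hMn' hn1
    have hNpos : (0 : ℝ) < N n := by exact_mod_cast NeZero.pos (N n)
    have hνpos : 0 < ν n := Nat.ceil_pos.2 hmn
    have hνpos' : (0 : ℝ) < ν n := by exact_mod_cast hνpos
    have hceil := Nat.le_ceil (m n)
    have hq1 : ((2 : ℝ) ^ n)⁻¹ < 1 := inv_lt_one_of_one_lt₀ (one_lt_pow₀ one_lt_two (by omega))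
    have hqpos : (0 : ℝ) < ((2 : ℝ) ^ n)⁻¹ := by positivity
    have hdev := le_meanCubeDist_of_deviation (n := n) (ν n) hMn.2.le
    have hst := choose_mul_pow_eq_stirling (ν n) (N n - ν n) hνpos (by omega) ((2 : ℝ) ^ n)⁻¹
    have hkl := exp_neg_le_pow_mul_pow (ν n) (N n - ν n) hνpos (by omega) (m n) hmn
      (by rw [hMn.1]; linarith)
    rw [hMn.1] at hst hkl
    rw [Nat.add_sub_cancel' hMn.2.le] at hst
    simp only [add_sub_cancel] at hst hkl
    have e0 : (N n : ℝ) * (1 - ((2 : ℝ) ^ n)⁻¹) = N n - m n := by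
      simp only [hm_def]; ring
    rw [e0] at hst
    have hSpos : 0 ≤ Stirling.stirlingSeq (N n) /
        (Stirling.stirlingSeq (ν n) * Stirling.stirlingSeq (N n - ν n)) := by
      unfold Stirling.stirlingSeq; positivity
    have hsq : √(c n) * √((N n : ℝ) / (2 * ν n * (N n - ν n))) =
        √((m n / c n)⁻¹ * ((ν n / m n)⁻¹ * (((N n : ℝ) - ν n) / N n)⁻¹) / 2) := by
      rw [← Real.sqrt_mul hcn.le]
      congr 1
      field_simp
    have hνm' : (ν n : ℝ) / m n = 2 ^ n / N n * ν n := by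
      simp only [hm_def]
      field_simp
    refine le_trans ?_ (mul_le_mul_of_nonneg_left hdev (Real.sqrt_nonneg _))
    have e1 : N n + 1 - ν n = (N n - ν n) + 1 := by omega
    rw [e1, pow_succ (1 - ((2 : ℝ) ^ n)⁻¹)]
    have e2 : √(c n) * (2 ^ n / N n * (ν n * (N n).choose (ν n) * ((2 : ℝ) ^ n)⁻¹ ^ ν n *
        ((1 - ((2 : ℝ) ^ n)⁻¹) ^ (N n - ν n) * (1 - ((2 : ℝ) ^ n)⁻¹)))) =
        (2 ^ n / N n * ν n) * (1 - ((2 : ℝ) ^ n)⁻¹) * (√(c n) * ((N n).choose (ν n) *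
          ((2 : ℝ) ^ n)⁻¹ ^ ν n * (1 - ((2 : ℝ) ^ n)⁻¹) ^ (N n - ν n))) := by ring
    rw [e2, hst, ← hνm', ← hsq]
    have hq1' : 0 ≤ 1 - ((2 : ℝ) ^ n)⁻¹ := by linarith
    have hmul : ∀ {A S x y R R' : ℝ}, 0 ≤ A → 0 ≤ S → 0 ≤ x → 0 ≤ y → R ≤ R' →
        A * (S * (x * y) * R) ≤ A * (x * (S * y * R')) := by
      intro A S x y R R' hA hS hx hy hR
      calc A * (S * (x * y) * R) ≤ A * (S * (x * y) * R') := by gcongr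
        _ = _ := by ring
    exact hmul (by positivity) hSpos (Real.sqrt_nonneg _) (Real.sqrt_nonneg _) hkl
  · filter_upwards [hNe, hcpos] with n hn hcn
    have hNpos : (0 : ℝ) < N n := by exact_mod_cast NeZero.pos (N n)
    refine (mul_le_mul_of_nonneg_left (meanCubeDist_le_sqrt (n := n) (N := N n))
      (Real.sqrt_nonneg _)).trans (le_of_eq ?_)
    rw [← Real.sqrt_mul hcn.le]
    congr 1
    simp only [hm_def]
    field_simp

end LargeSamples

/-! ### Samples much smaller than the cube: polynomial and exponential sizes. -/

section SmallSamples

/-- Smoothing the empirical measure by flipping the coordinates independently. -/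
lemma meanCubeDist_le_noise {n N : ℕ} [NeZero N] (p : ℝ) (hp0 : 0 ≤ p) (hp1 : p ≤ 1) :
    meanCubeDist n N ≤ n * p + n / 2 * √((1 + (1 - 2 * p) ^ 2) ^ n / N) := by
  have hp1' : 0 ≤ 1 - p := sub_nonneg.2 hp1
  have h1 : ∑ k ∈ Finset.range (n + 1), n.choose k * (p ^ k * (1 - p) ^ (n - k)) = 1 := by
    have := add_pow p (1 - p) n
    rw [add_sub_cancel, one_pow] at this
    refine Eq.trans (Finset.sum_congr rfl fun k _ => ?_) this.symm
    ring
  have h2 : ∑ k ∈ Finset.range (n + 1), n.choose k * (p ^ k * (1 - p) ^ (n - k) * k) = n * p := by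
    -- The mean of the binomial law: the telescoped sum over `k < n` cancels the term `k = n`.
    have hdev := sum_range_binomial_deviation n n le_rfl p
    rw [Nat.choose_self, Nat.add_sub_cancel_left] at hdev
    have hsum : ∑ k ∈ Finset.range (n + 1),
        n.choose k * p ^ k * (1 - p) ^ (n - k) * (n * p - k) = 0 := by
      rw [Finset.sum_range_succ, hdev, Nat.choose_self, Nat.sub_self]
      push_cast
      ring
    have hsplit : ∑ k ∈ Finset.range (n + 1),
        n.choose k * p ^ k * (1 - p) ^ (n - k) * (n * p - k) =
        n * p * ∑ k ∈ Finset.range (n + 1), n.choose k * (p ^ k * (1 - p) ^ (n - k)) -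
        ∑ k ∈ Finset.range (n + 1), n.choose k * (p ^ k * (1 - p) ^ (n - k) * k) := by
      rw [Finset.mul_sum, ← Finset.sum_sub_distrib]
      exact Finset.sum_congr rfl fun k _ => by ring
    rw [hsum, h1] at hsplit
    linarith
  have h3 : 2 ^ n * ∑ k ∈ Finset.range (n + 1), n.choose k * (p ^ k * (1 - p) ^ (n - k)) ^ 2 =
      (1 + (1 - 2 * p) ^ 2) ^ n := by
    have := add_pow (p ^ 2) ((1 - p) ^ 2) n
    rw [show 1 + (1 - 2 * p) ^ 2 = 2 * (p ^ 2 + (1 - p) ^ 2) by ring, mul_pow, this]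
    congr 1
    refine Finset.sum_congr rfl fun k _ => ?_
    rw [mul_pow, ← pow_mul, ← pow_mul, ← pow_mul, ← pow_mul, mul_comm 2 k, mul_comm 2 (n - k)]
    ring
  have h := meanCubeDist_le_of_radial (n := n) (N := N) (fun k => p ^ k * (1 - p) ^ (n - k))
    (fun k => by positivity) h1
  rwa [h2, h3] at h

/-- Smoothing the empirical measure over spheres of radius `k`. -/
lemma meanCubeDist_le_sphere {n N : ℕ} [NeZero N] (k : ℕ) (hk : k ≤ n) :
    meanCubeDist n N ≤ k + n / 2 * √(2 ^ n / (N * n.choose k)) := by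
  have hc : (n.choose k : ℝ) ≠ 0 := by exact_mod_cast (Nat.choose_pos hk).ne'
  have hmem : k ∈ Finset.range (n + 1) := Finset.mem_range.2 (Nat.lt_succ_of_le hk)
  have h := meanCubeDist_le_of_radial (n := n) (N := N)
    (fun j => if j = k then (n.choose k : ℝ)⁻¹ else 0)
    (fun j => by split_ifs <;> positivity) (by simp [hc, Nat.lt_succ_of_le hk])
  refine h.trans (le_of_eq ?_)
  simp only [ite_mul, zero_mul, mul_ite, mul_zero, Finset.sum_ite_eq', hmem, if_true, ite_pow,
    ne_eq, OfNat.ofNat_ne_zero, not_false_eq_true, zero_pow]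
  congr 3
  · field_simp
  · field_simp

lemma tendsto_log_div_self : Tendsto (fun n : ℕ => Real.log n / n) atTop (𝓝 0) :=
  (Real.isLittleO_log_id_atTop.tendsto_div_nhds_zero).comp tendsto_natCast_atTop_atTop

lemma bounds_of_abs_sub_lt_one {x y : ℝ} (h : |x - y| < 1) (hy : 2 ≤ y) :
    y / 2 ≤ x ∧ x ≤ 2 * y := by
  have := abs_lt.1 h
  constructor <;> linarith

lemma sqrt_mul_log (n : ℕ) (hn : 0 < n) :
    √((n : ℝ) * Real.log n) = n * √(Real.log n / n) := by
  have hn' : (0 : ℝ) < n := by exact_mod_cast hn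
  calc √((n : ℝ) * Real.log n) = √((n : ℝ) ^ 2 * (Real.log n / n)) := by
        congr 1
        field_simp
    _ = n * √(Real.log n / n) := by rw [Real.sqrt_mul (by positivity), Real.sqrt_sq hn'.le]

/-- With `κ = n / 2 - t √(n log n)`, a ball of radius `κ` has measure at most `n ^ (-2t²) = n ^ (-(α
+ 1))`. Then `N ≤ 2 n ^ α` balls cover at most `2 / n`, and the loss of this fraction of `κ ≤ n / 2`
costs at most `1`. -/
lemma mean_ge_of_polynomial {n N : ℕ} [NeZero N] (α t : ℝ) (ht : 0 ≤ t)
    (ht2 : 2 * t ^ 2 = α + 1) (hn : 2 ≤ n) (hsmall : t * √(Real.log n / n) ≤ 1 / 2)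
    (hN : (N : ℝ) ≤ 2 * Real.exp (α * Real.log n)) :
    n / 2 - meanCubeDist n N ≤ t * √(n * Real.log n) + 1 := by
  have hn' : (2 : ℝ) ≤ n := by exact_mod_cast hn
  have hn0 : (0 : ℝ) < n := by linarith
  have hlog : 0 ≤ Real.log n := Real.log_nonneg (by linarith)
  set w := √(Real.log n / n) with hw
  have hw0 : 0 ≤ w := Real.sqrt_nonneg _
  have hw2 : n * w ^ 2 = Real.log n := by
    rw [hw, Real.sq_sqrt (by positivity)]
    field_simp
  rw [sqrt_mul_log n (by omega), ← hw]
  set κ : ℝ := n / 2 - t * (n * w) with hκ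
  have hκ0 : 0 ≤ κ := by nlinarith
  have hκn : κ ≤ n / 2 := by
    have : 0 ≤ t * (n * w) := by positivity
    linarith
  -- This `σ` minimises the exponent `n σ² / 2 - 2 t n w σ` that remains after `cosh σ ≤ exp (σ² /
  -- 2)`.
  set σ : ℝ := 2 * t * w with hσ
  have hσ0 : 0 ≤ σ := by positivity
  have h := le_meanCubeDist_of_ball (n := n) (N := N) κ (Real.exp (-(2 * σ))) hκ0
    (Real.exp_pos _) (Real.exp_le_one_iff.2 (by linarith))
  have hball : (1 + Real.exp (-(2 * σ))) ^ n * Real.exp (-(2 * σ)) ^ (-κ) / 2 ^ n ≤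
      Real.exp (-((α + 1) * Real.log n)) := by
    have e1 : (1 + Real.exp (-(2 * σ))) / 2 = Real.exp (-σ) * Real.cosh σ := by
      rw [Real.cosh_eq, show -(2 * σ) = -σ + -σ by ring, Real.exp_add]
      have : Real.exp (-σ) * Real.exp σ = 1 := by rw [← Real.exp_add]; simp
      linear_combination (-1 / 2) * this
    calc (1 + Real.exp (-(2 * σ))) ^ n * Real.exp (-(2 * σ)) ^ (-κ) / 2 ^ n
        = ((1 + Real.exp (-(2 * σ))) / 2) ^ n * Real.exp (2 * σ * κ) := by
          rw [← Real.exp_mul, div_pow]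
          ring_nf
      _ ≤ (Real.exp (-σ) * Real.exp (σ ^ 2 / 2)) ^ n * Real.exp (2 * σ * κ) := by
          rw [e1]
          have := Real.cosh_pos σ
          gcongr
          exact Real.cosh_le_exp_half_sq σ
      _ = Real.exp (-((α + 1) * Real.log n)) := by
          rw [← Real.exp_add, ← Real.exp_nat_mul, ← Real.exp_add, ← ht2, ← hw2]
          congr 1
          simp only [hσ, hκ]
          ring
  have hsmall : κ * (N * ((1 + Real.exp (-(2 * σ))) ^ n * Real.exp (-(2 * σ)) ^ (-κ) / 2 ^ n)) ≤
      1 := by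
    calc κ * (N * ((1 + Real.exp (-(2 * σ))) ^ n * Real.exp (-(2 * σ)) ^ (-κ) / 2 ^ n))
        ≤ n / 2 * (2 * Real.exp (α * Real.log n) * Real.exp (-((α + 1) * Real.log n))) := by
          gcongr
      _ = n * Real.exp (-Real.log n) := by
          rw [mul_assoc 2, ← Real.exp_add]
          ring_nf
      _ = 1 := by
          rw [Real.exp_neg, Real.exp_log hn0, mul_inv_cancel₀ hn0.ne']
  rw [mul_sub, mul_one] at h
  linarith

/-- Flipping with probability `1 / 2 - t w` gives variance factor `(1 + 4t²w²) ^ n ≤ n ^ (4t²) = n ^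
(α - 2)`. Divided by `N ≥ n ^ α / 2`, its root is at most `2 / n`, which balances the repair cost `n
/ 2`. -/
lemma mean_le_of_polynomial {n N : ℕ} [NeZero N] (α t : ℝ) (ht : 0 ≤ t)
    (ht2 : 4 * t ^ 2 = α - 2) (hn : 2 ≤ n) (hsmall : t * √(Real.log n / n) ≤ 1 / 2)
    (hN : Real.exp (α * Real.log n) / 2 ≤ N) :
    t * √(n * Real.log n) - 1 ≤ n / 2 - meanCubeDist n N := by
  have hn' : (2 : ℝ) ≤ n := by exact_mod_cast hn
  have hn0 : (0 : ℝ) < n := by linarith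
  have hlog : 0 ≤ Real.log n := Real.log_nonneg (by linarith)
  have hNpos : (0 : ℝ) < N := by exact_mod_cast NeZero.pos N
  set w := √(Real.log n / n) with hw
  have hw0 : 0 ≤ w := Real.sqrt_nonneg _
  have hw2 : n * w ^ 2 = Real.log n := by
    rw [hw, Real.sq_sqrt (by positivity)]
    field_simp
  rw [sqrt_mul_log n (by omega), ← hw]
  have htw : 0 ≤ t * w := by positivity
  have h := meanCubeDist_le_noise (n := n) (N := N) (1 / 2 - t * w) (by linarith) (by linarith)
  have hsq : √((1 + (1 - 2 * (1 / 2 - t * w)) ^ 2) ^ n / N) ≤ 2 / n := by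
    rw [Real.sqrt_le_left (by positivity), div_le_iff₀ hNpos]
    calc (1 + (1 - 2 * (1 / 2 - t * w)) ^ 2) ^ n
        ≤ Real.exp (4 * t ^ 2 * w ^ 2) ^ n := by
          gcongr
          have := Real.add_one_le_exp (4 * t ^ 2 * w ^ 2)
          linarith
      _ = Real.exp (α * Real.log n) / n ^ 2 := by
          rw [← Real.exp_nat_mul, show (n : ℝ) * (4 * t ^ 2 * w ^ 2) = 4 * t ^ 2 * (n * w ^ 2) by
            ring, hw2, ht2, sub_mul, Real.exp_sub]
          congr 1
          rw [two_mul, Real.exp_add, Real.exp_log hn0, pow_two]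
      _ ≤ (2 / n) ^ 2 * N := by
          rw [div_pow, div_mul_eq_mul_div]
          gcongr
          linarith
  have : n / 2 * √((1 + (1 - 2 * (1 / 2 - t * w)) ^ 2) ^ n / N) ≤ 1 := by
    calc n / 2 * √((1 + (1 - 2 * (1 / 2 - t * w)) ^ 2) ^ n / N) ≤ (n : ℝ) / 2 * (2 / n) := by
          gcongr
      _ = 1 := by field_simp
  nlinarith

lemma limitsBetween_of_polynomial (N : ℕ → ℕ) (α : ℝ) (hα : 2 ≤ α)
    (hN : ∀ᶠ n in atTop, |(N n : ℝ) - (n : ℝ) ^ α| < 1) :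
    LimitsBetween (√((α - 2) / 4))
      (fun n => ((n : ℝ) / 2 - meanCubeDist n (N n)) / √(n * Real.log n)) (√((α + 1) / 2)) := by
  have hlogtop : Tendsto (fun n : ℕ => Real.log n) atTop atTop :=
    Real.tendsto_log_atTop.comp tendsto_natCast_atTop_atTop
  have hroot : Tendsto (fun n : ℕ => √((n : ℝ) * Real.log n)) atTop atTop :=
    Real.tendsto_sqrt_atTop.comp (tendsto_natCast_atTop_atTop.atTop_mul_atTop₀ hlogtop)
  have hinv : Tendsto (fun n : ℕ => (√((n : ℝ) * Real.log n))⁻¹) atTop (𝓝 0) :=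
    tendsto_inv_atTop_zero.comp hroot
  have hsmall : ∀ t : ℝ, ∀ᶠ n : ℕ in atTop, t * √(Real.log n / n) ≤ 1 / 2 := by
    intro t
    have h := ((Real.continuous_sqrt.tendsto _).comp tendsto_log_div_self).const_mul t
    rw [Real.sqrt_zero, mul_zero] at h
    exact h.eventually_le_const (by norm_num)
  have hNb : ∀ᶠ n : ℕ in atTop, Real.exp (α * Real.log n) / 2 ≤ N n ∧
      (N n : ℝ) ≤ 2 * Real.exp (α * Real.log n) ∧ NeZero (N n) ∧ 2 ≤ n := by
    filter_upwards [hN, eventually_ge_atTop 2] with n hn h2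
    have h2' : (2 : ℝ) ≤ n := by exact_mod_cast h2
    have he : (n : ℝ) ^ α = Real.exp (α * Real.log n) := by
      rw [Real.rpow_def_of_pos (by linarith), mul_comm]
    have hge : (2 : ℝ) ≤ (n : ℝ) ^ α := by
      calc (2 : ℝ) ≤ n := h2'
        _ = (n : ℝ) ^ (1 : ℝ) := (Real.rpow_one _).symm
        _ ≤ (n : ℝ) ^ α := Real.rpow_le_rpow_of_exponent_le (by linarith) (by linarith)
    obtain ⟨h3, h4⟩ := bounds_of_abs_sub_lt_one hn hge
    rw [he] at h3 h4
    refine ⟨h3, h4, ⟨fun h0 => ?_⟩, h2⟩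
    rw [h0, Nat.cast_zero] at h3
    linarith [Real.exp_pos (α * Real.log n)]
  refine LimitsBetween.of_tendsto
    (l := fun n => √((α - 2) / 4) - (√((n : ℝ) * Real.log n))⁻¹)
    (v := fun n => √((α + 1) / 2) + (√((n : ℝ) * Real.log n))⁻¹) ?_ ?_ ?_ ?_
  · simpa using hinv.const_sub (√((α - 2) / 4))
  · simpa using hinv.const_add (√((α + 1) / 2))
  · filter_upwards [hNb, hsmall (√((α - 2) / 4)), hroot.eventually_gt_atTop 0] with n hb hs hpos
    obtain ⟨h1, -, hne, h2⟩ := hb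
    have h := mean_le_of_polynomial α (√((α - 2) / 4)) (Real.sqrt_nonneg _)
      (by rw [Real.sq_sqrt (by linarith)]; ring) h2 hs h1
    rw [le_div_iff₀ hpos, sub_mul, inv_mul_cancel₀ hpos.ne']
    exact h
  · filter_upwards [hNb, hsmall (√((α + 1) / 2)), hroot.eventually_gt_atTop 0] with n hb hs hpos
    obtain ⟨-, h1, hne, h2⟩ := hb
    have h := mean_ge_of_polynomial α (√((α + 1) / 2)) (Real.sqrt_nonneg _)
      (by rw [Real.sq_sqrt (by linarith)]; ring) h2 hs h1
    rw [div_le_iff₀ hpos, add_mul, inv_mul_cancel₀ hpos.ne']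
    exact h

lemma existsUnique_binEntropy_eq (l : ℝ) (hl : 0 < l) (hl2 : l < Real.log 2) :
    ∃! r : ℝ, r ∈ Set.Ioo 0 (1 / 2) ∧ Real.binEntropy r = Real.log 2 - l := by
  have hmono := Real.binEntropy_strictMonoOn
  have hsub : Set.Ioo (0 : ℝ) (1 / 2) ⊆ Set.Icc 0 2⁻¹ := fun x hx =>
    ⟨hx.1.le, by rw [← one_div]; exact hx.2.le⟩
  obtain ⟨r, hr, hre⟩ := intermediate_value_Ioo (a := (0 : ℝ)) (b := 1 / 2) (by norm_num)
    Real.binEntropy_continuous.continuousOn (show Real.log 2 - l ∈ Set.Ioo _ _ by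
      rw [Real.binEntropy_zero, one_div, Real.binEntropy_two_inv]
      constructor <;> linarith)
  exact ⟨r, ⟨hr, hre⟩, fun y hy =>
    hmono.injOn (hsub hy.1) (hsub hr) (hy.2.trans hre.symm)⟩

/-- The ratio `r / (1 - r)` is the optimal Chernoff parameter at radius `r * n`. With it held fixed,
the exponent is affine in the radius. -/
lemma exp_nat_mul_binEntropy (n : ℕ) (r : ℝ) (hr0 : 0 < r) (hr1 : r < 1) (κ : ℝ) :
    (1 + r / (1 - r)) ^ n * (r / (1 - r)) ^ (-κ) =
      Real.exp (n * Real.binEntropy r + Real.log ((1 - r) / r) * (κ - r * n)) := by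
  have h1 : 0 < 1 - r := by linarith
  have e1 : 1 + r / (1 - r) = (1 - r)⁻¹ := by field_simp; ring
  rw [e1, Real.rpow_def_of_pos (by positivity), ← Real.exp_log (pow_pos (inv_pos.2 h1) n),
    ← Real.exp_add, Real.log_pow, Real.log_inv, Real.log_div hr0.ne' h1.ne',
    Real.log_div h1.ne' hr0.ne', Real.binEntropy_eq_negMulLog_add_negMulLog_one_sub,
    Real.negMulLog, Real.negMulLog]
  congr 1
  ring

lemma limitsBetween_of_exponential (N : ℕ → ℕ) (l : ℝ) (hl : 0 < l)
    (hN : ∀ᶠ n : ℕ in atTop, |(N n : ℝ) - Real.exp (l * n)| < 1) (r : ℝ)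
    (hr : r ∈ Set.Ioo 0 (1 / 2)) (hrl : Real.binEntropy r = Real.log 2 - l) :
    LimitsBetween (-(1 / Real.log ((1 - r) / r)))
      (fun n => (meanCubeDist n (N n) - r * n) / Real.log n)
      (3.5 / Real.log ((1 - r) / r)) := by
  obtain ⟨hr0, hr2⟩ := hr
  have hr1 : 0 < 1 - r := by linarith
  set L := Real.log ((1 - r) / r) with hL
  have hLpos : 0 < L := Real.log_pos (by rw [lt_div_iff₀ hr0]; linarith)
  have hlogtop : Tendsto (fun n : ℕ => Real.log n) atTop atTop :=
    Real.tendsto_log_atTop.comp tendsto_natCast_atTop_atTop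
  have hinv : Tendsto (fun n : ℕ => (Real.log n)⁻¹) atTop (𝓝 0) :=
    tendsto_inv_atTop_zero.comp hlogtop
  have h2pow : ∀ n : ℕ, (2 : ℝ) ^ n = Real.exp (n * Real.log 2) := fun n => by
    rw [Real.exp_nat_mul, Real.exp_log (by norm_num)]
  have hNb : ∀ᶠ n : ℕ in atTop, Real.exp (l * n) / 2 ≤ N n ∧
      (N n : ℝ) ≤ 2 * Real.exp (l * n) ∧ NeZero (N n) := by
    have hE : Tendsto (fun n : ℕ => Real.exp (l * n)) atTop atTop :=
      Real.tendsto_exp_atTop.comp (tendsto_natCast_atTop_atTop.const_mul_atTop hl)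
    filter_upwards [hN, hE.eventually_ge_atTop 2] with n hn h2
    obtain ⟨h3, h4⟩ := bounds_of_abs_sub_lt_one hn h2
    refine ⟨h3, h4, ⟨fun h0 => ?_⟩⟩
    rw [h0, Nat.cast_zero] at h3
    linarith
  refine LimitsBetween.of_tendsto
    (l := fun n => -(1 / L) - (Real.log n)⁻¹)
    (v := fun n => 3.5 / L + 2 * (Real.log n)⁻¹) ?_ ?_ ?_ ?_
  · simpa using hinv.const_sub (-(1 / L))
  · simpa using (hinv.const_mul 2).const_add (3.5 / L)
  · have hκ : ∀ᶠ n : ℕ in atTop, Real.log n / n ≤ r * L :=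
      tendsto_log_div_self.eventually_le_const (by positivity)
    filter_upwards [hNb, hκ, hlogtop.eventually_gt_atTop 0, eventually_ge_atTop 1]
      with n ⟨_, hNle, hne⟩ hκ hlog hn1
    have hn0 : (0 : ℝ) < n := by exact_mod_cast hn1
    rw [div_le_iff₀ hn0] at hκ
    have hκ0 : 0 ≤ r * n - Real.log n / L := by
      rw [sub_nonneg, div_le_iff₀ hLpos]; linarith
    -- Lowering the radius from `r * n` by `log n / L` gains a factor `1 / n`, so the part of the
    -- cube near the sample costs only `O(1)`.
    have h := le_meanCubeDist_of_ball (n := n) (N := N n) (r * n - Real.log n / L) (r / (1 - r))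
      hκ0 (by positivity) (by rw [div_le_one hr1]; linarith)
    rw [exp_nat_mul_binEntropy n r hr0 (by linarith), ← hL] at h
    have hsmall : N n * (Real.exp (n * Real.binEntropy r +
        L * (r * n - Real.log n / L - r * n)) / 2 ^ n) ≤ 2 / n := by
      calc N n * (Real.exp (n * Real.binEntropy r +
            L * (r * n - Real.log n / L - r * n)) / 2 ^ n)
          ≤ 2 * Real.exp (l * n) * (Real.exp (n * Real.binEntropy r +
            L * (r * n - Real.log n / L - r * n)) / 2 ^ n) := by gcongr
        _ = 2 * Real.exp (-Real.log n) := by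
            rw [h2pow, ← Real.exp_sub, mul_assoc, ← Real.exp_add, hrl]
            congr 2
            field_simp
            ring
        _ = 2 / n := by rw [Real.exp_neg, Real.exp_log hn0]; rfl
    have hlogL : 0 ≤ Real.log n / L := by positivity
    have h5 : (r * n - Real.log n / L) * (1 - 2 / n) ≤ meanCubeDist n (N n) :=
      le_trans (by gcongr) h
    have h6 : (r * n - Real.log n / L) * (2 / n) ≤ 1 := by
      calc (r * n - Real.log n / L) * (2 / n) ≤ (r * n) * (2 / n) := by
            gcongr; linarith
        _ = 2 * r := by field_simp
        _ ≤ 1 := by linarith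
    rw [le_div_iff₀ hlog]
    have h7 : (-(1 / L) - (Real.log n)⁻¹) * Real.log n = -(Real.log n / L) - 1 := by
      field_simp
    rw [h7]
    linarith
  · set k : ℕ → ℕ := fun n => ⌈r * n + 3.5 / L * Real.log n⌉₊ with hk
    have hkpos : ∀ᶠ n : ℕ in atTop, r * n + 3.5 / L * Real.log n ≤ k n ∧
        (k n : ℝ) ≤ r * n + 3.5 / L * Real.log n + 1 := by
      filter_upwards [hlogtop.eventually_gt_atTop 0] with n hn
      exact ⟨Nat.le_ceil _, (Nat.ceil_lt_add_one (by positivity)).le⟩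
    have hkn : Tendsto (fun n => (k n : ℝ) / n) atTop (𝓝 r) := by
      have hlo : Tendsto (fun n : ℕ => r + 3.5 / L * (Real.log n / n)) atTop (𝓝 r) := by
        simpa using (tendsto_log_div_self.const_mul (3.5 / L)).const_add r
      have hup : Tendsto (fun n : ℕ => r + 3.5 / L * (Real.log n / n) + (n : ℝ)⁻¹) atTop (𝓝 r) := by
        simpa using hlo.add tendsto_inv_atTop_nhds_zero_nat
      refine tendsto_of_tendsto_of_tendsto_of_le_of_le' hlo hup ?_ ?_
      · filter_upwards [hkpos, eventually_ge_atTop 1] with n h hn1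
        have hn0 : (0 : ℝ) < n := by exact_mod_cast hn1
        rw [le_div_iff₀ hn0]
        refine le_trans (le_of_eq ?_) h.1
        field_simp
      · filter_upwards [hkpos, eventually_ge_atTop 1] with n h hn1
        have hn0 : (0 : ℝ) < n := by exact_mod_cast hn1
        rw [div_le_iff₀ hn0]
        refine h.2.trans (le_of_eq ?_)
        field_simp
    -- By concavity the entropy gain is bounded below by the slope at `k / n`, which tends to `L`. A
    -- gain of `3 log n` is needed; the constant `3.5` leaves room for a slope slightly below `L`.
    have hslope : ∀ᶠ n : ℕ in atTop,
        3 / 3.5 * L ≤ Real.log ((1 - (k n : ℝ) / n) / ((k n : ℝ) / n)) := by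
      have h : Tendsto (fun n : ℕ => Real.log ((1 - (k n : ℝ) / n) / ((k n : ℝ) / n))) atTop
          (𝓝 L) := ((hkn.const_sub 1).div hkn hr0.ne').log (by positivity)
      exact h.eventually_const_le (by norm_num; linarith)
    filter_upwards [hNb, hkpos, hslope, hkn.eventually_lt_const (show r < 1 by linarith),
      hlogtop.eventually_gt_atTop 0, eventually_ge_atTop 1]
      with n ⟨hNge, _, hne⟩ ⟨hk1, hk2⟩ hs hlt hlog hn1
    have hn0 : (0 : ℝ) < n := by exact_mod_cast hn1
    have hn1' : (1 : ℝ) ≤ n := by exact_mod_cast hn1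
    have hNpos : (0 : ℝ) < N n := by exact_mod_cast NeZero.pos (N n)
    have hkn' : k n < n := by
      rw [div_lt_one hn0] at hlt
      exact_mod_cast hlt
    have hk0' : (0 : ℝ) < k n := lt_of_lt_of_le (by positivity) hk1
    have hk0 : 0 < k n := by exact_mod_cast hk0'
    have hC : (0 : ℝ) < n.choose (k n) := by exact_mod_cast Nat.choose_pos hkn'.le
    have hchoose := exp_binEntropy_le_choose n (k n) hk0 hkn'
    have hrk : r + 3.5 / L * Real.log n / n ≤ (k n : ℝ) / n := by
      rw [le_div_iff₀ hn0]
      refine le_trans (le_of_eq ?_) hk1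
      field_simp
    have hrk' : 0 ≤ 3.5 / L * Real.log n / n := by positivity
    have htan := binEntropy_add_le r ((k n : ℝ) / n) hr0 (by linarith) hlt
    have hent : n * (Real.log 2 - l) + 3 * Real.log n ≤ n * Real.binEntropy ((k n : ℝ) / n) := by
      have hle : 3.5 / L * Real.log n / n * (3 / 3.5 * L) ≤
          ((k n : ℝ) / n - r) * Real.log ((1 - (k n : ℝ) / n) / ((k n : ℝ) / n)) :=
        mul_le_mul (by linarith) hs (by positivity) (by linarith)
      rw [hrl] at htan
      calc n * (Real.log 2 - l) + 3 * Real.log n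
          = n * (Real.log 2 - l + 3.5 / L * Real.log n / n * (3 / 3.5 * L)) := by
            field_simp
        _ ≤ _ := by gcongr; linarith
    -- Of the gained factor `n ^ 3`, one power pays for the `n + 1` lost in the entropy bound, and
    -- two make the root at most `2 / n`.
    have hsq : √(2 ^ n / (N n * n.choose (k n))) ≤ 2 / n := by
      rw [Real.sqrt_le_left (by positivity), div_le_iff₀ (by positivity)]
      have hprod : (2 : ℝ) ^ n * n ^ 3 / 2 ≤ N n * ((n + 1) * n.choose (k n)) := by
        calc (2 : ℝ) ^ n * n ^ 3 / 2
            = Real.exp (l * n) / 2 * Real.exp (n * (Real.log 2 - l) + 3 * Real.log n) := by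
              rw [h2pow, div_mul_eq_mul_div, ← Real.exp_add]
              have : (n : ℝ) ^ 3 = Real.exp (3 * Real.log n) := by
                rw [show (3 : ℝ) * Real.log n = (3 : ℕ) * Real.log n by norm_num,
                  Real.exp_nat_mul, Real.exp_log hn0]
              rw [this, ← Real.exp_add]
              ring_nf
          _ ≤ N n * ((n + 1) * n.choose (k n)) := by
              gcongr
              exact (Real.exp_le_exp.2 hent).trans hchoose
      have hprod' : (2 : ℝ) ^ n * n ^ 3 / 2 ≤ (2 * n) * (N n * n.choose (k n)) := by
        refine hprod.trans ?_
        calc N n * ((n + 1) * n.choose (k n)) = (n + 1) * (N n * n.choose (k n) : ℝ) := by ring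
          _ ≤ _ := by gcongr; linarith
      rw [div_pow, div_mul_eq_mul_div, le_div_iff₀ (by positivity)]
      refine le_of_mul_le_mul_right ?_ hn0
      linarith
    have h := meanCubeDist_le_sphere (n := n) (N := N n) (k n) hkn'.le
    have h1 : n / 2 * √(2 ^ n / (N n * n.choose (k n))) ≤ 1 := by
      calc n / 2 * √(2 ^ n / (N n * n.choose (k n))) ≤ (n : ℝ) / 2 * (2 / n) := by gcongr
        _ = 1 := by field_simp
    rw [div_le_iff₀ hlog]
    have h7 : (3.5 / L + 2 * (Real.log n)⁻¹) * Real.log n = 3.5 / L * Real.log n + 2 := by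
      field_simp
    rw [h7]
    linarith

end SmallSamples

theorem theorem1
    (N : ℕ → ℕ)
    {Ω : ℕ → Type*} [∀ n, MeasurableSpace (Ω n)]
    (P : ∀ n, Measure (Ω n)) [∀ n, IsProbabilityMeasure (P n)]
    (X : ∀ n, Fin (N n) → Ω n → BoolCube n)
    (hindep : ∀ n, iIndepFun (X n) (P n))
    (hlaw : ∀ n i, HasLaw (X n i) (cubeUniform n) (P n)) :
    -- `N = n ^ α`, up to rounding to an integer
    (∀ α : ℝ, 2 ≤ α → (∀ᶠ n in atTop, |(N n : ℝ) - (n : ℝ) ^ α| < 1) →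
      LimitsBetween (√((α - 2) / 4))
        (fun n => ((n : ℝ) / 2 - meanMatchingDist (P n) (X n)) / √(n * Real.log n))
        (√((α + 1) / 2))) ∧
    -- `N = e ^ (l n)`, up to rounding to an integer
    (∀ l : ℝ, 0 < l → l < Real.log 2 → (∀ᶠ n in atTop, |(N n : ℝ) - Real.exp (l * n)| < 1) →
      (∃! r : ℝ, r ∈ Set.Ioo 0 (1 / 2) ∧ Real.binEntropy r = Real.log 2 - l) ∧
      ∀ r : ℝ, r ∈ Set.Ioo 0 (1 / 2) → Real.binEntropy r = Real.log 2 - l →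
        LimitsBetween (-(1 / Real.log ((1 - r) / r)))
          (fun n => (meanMatchingDist (P n) (X n) - r * n) / Real.log n)
          (3.5 / Real.log ((1 - r) / r))) ∧
    -- `N = c 2 ^ n`, up to rounding to an integer
    (∀ c : ℝ, 0 < c → (∀ᶠ n in atTop, |(N n : ℝ) - c * 2 ^ n| < 1) →
      LimitsBetween (Real.exp (-c))
        (fun n => meanMatchingDist (P n) (X n))
        (1 / √(2 * c))) ∧
    -- `N = c(n) 2 ^ n` with `c(n) → ∞`, up to rounding to an integer
    (∀ c : ℕ → ℝ, Tendsto c atTop atTop → (∀ᶠ n in atTop, |(N n : ℝ) - c n * 2 ^ n| < 1) →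
      LimitsBetween (√(1 / (2 * Real.pi)))
        (fun n => √(c n) * meanMatchingDist (P n) (X n))
        (√2 / 2)) := by
  have hmean : ∀ n, meanMatchingDist (P n) (X n) = meanCubeDist n (N n) := fun n =>
    meanMatchingDist_eq (P n) (X n) (hindep n) (hlaw n)
  simp only [hmean]
  exact ⟨fun α hα hN => limitsBetween_of_polynomial N α hα hN,
    fun l hl hl2 hN => ⟨existsUnique_binEntropy_eq l hl hl2,
      fun r hr hrl => limitsBetween_of_exponential N l hl hN r hr hrl⟩,
    fun c hc hN => limitsBetween_of_constant_density N c hc hN,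
    fun c hc hN => limitsBetween_of_density_atTop N c hc hN⟩
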